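/- For a natural number $m\ge 1$ let $\mathfrak P_m(\Gamma)$ be the set of polynomials $P_m(z)=\prod_{j=1}^m (z-e^{i\phi_j})$, $\phi_1,\dots,\phi_m\in\mathbb R$, i.e. of monic complex polynomials of degree $m$ all of whose zeros lie on the unit circle, and for $0<h<2$ put $$\delta_m(h)=\inf\bigl\{\operatorname{mes}\{t\in[0,2\pi]:\ |P_m(e^{it})|\ge h\}:\ P_m\in\mathfrak P_m(\Gamma)\bigr\},$$ where $\operatorname{mes}$ is Lebesgue measure. A polynomial of $\mathfrak P_m(\Gamma)$ at which the infimum is attained is called extremal. For $0<\alpha<\pi$ and $m=2n$ or $m=2n+1$ put $$a_{km}(\alpha)=1-2\cos^2\frac{\pi(2k-1)}{2m}\,\sin^2\frac{\alpha}{2},\qquad S_n(z)=\prod_{k=1}^{n}\bigl(z^2-2a_{km}(\alpha)z+1\bigr),$$ and let $P_{m,\alpha}(z)=S_n(z)$ if $m=2n$ and $P_{m,\alpha}(z)=(z-1)S_n(z)$ if $m=2n+1$ (the Maergoiz–Rybakova polynomials). Theorem. For all $m\ge 1$ and $0<h<2$, $$\delta_m(h)=4\arccos\Bigl(\bigl(h/2\bigr)^{1/m}\Bigr).$$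 Moreover, if $\alpha$ is the unique number in $(0,\pi)$ with $h=2\sin^m(\alpha/2)$, then the extremal polynomials are exactly the rotations $e^{im\theta}P_{m,\alpha}(e^{-i\theta}z)$, $\theta\in\mathbb R$, of $P_{m,\alpha}$. -/

import Mathlib

open Real Polynomial MeasureTheory Set

noncomputable section

/-- The monic complex polynomials `∏ (z - e^{iφ_j})` of degree `m` all of whose `m` zeros
(with multiplicity) lie on the unit circle. -/
def circlePolynomials (m : ℕ) : Set ℂ[X] :=
  {P | ∃ φ : Fin m → ℝ, P = ∏ j, (X - C (Complex.exp ((φ j : ℂ) * Complex.I)))}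

/-- The Lebesgue measure of `{t ∈ [0, 2π] : |P(e^{it})| ≥ h}`. -/
def superlevelMeasure (P : ℂ[X]) (h : ℝ) : ℝ :=
  volume.real {t : ℝ | t ∈ Icc 0 (2 * π) ∧ h ≤ ‖P.eval (Complex.exp ((t : ℂ) * Complex.I))‖}

/-- `δ_m(h)`: the infimum of the measures over the monic polynomials of degree `m` with all
zeros on the unit circle. -/
def delta (m : ℕ) (h : ℝ) : ℝ :=
  sInf ((fun P : ℂ[X] => superlevelMeasure P h) '' circlePolynomials m)

/-- `P` attains the infimum `δ_m(h)`. -/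
def IsExtremal (m : ℕ) (h : ℝ) (P : ℂ[X]) : Prop :=
  P ∈ circlePolynomials m ∧ superlevelMeasure P h = delta m h

/-- The numbers `a_{km}(α) = 1 - 2 x_{km}² sin²(α/2)`, with
`x_{km} = cos (π (2k - 1) / (2m))`. -/
def mrCoeff (k m : ℕ) (α : ℝ) : ℝ :=
  1 - 2 * cos (π * (2 * (k : ℝ) - 1) / (2 * (m : ℝ))) ^ 2 * sin (α / 2) ^ 2

/-- The product of the `z² - 2 a_{km}(α) z + 1` over `k = 1, …, n`. -/
def mrProduct (n m : ℕ) (α : ℝ) : ℂ[X] :=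
  ∏ k ∈ Finset.Icc 1 n, (X ^ 2 - C ((2 * mrCoeff k m α : ℝ) : ℂ) * X + 1)

/-- The Maergoiz–Rybakova polynomial of degree `m`: `S_n(z)` if `m = 2n`, and
`(z - 1) S_n(z)` if `m = 2n + 1`. -/
def mrPolynomial (m : ℕ) (α : ℝ) : ℂ[X] :=
  if Even m then mrProduct (m / 2) m α else (X - 1) * mrProduct (m / 2) m α

/-- The rotation `e^{imθ} P(z e^{-iθ})` by the angle `θ` of a polynomial `P` of degree `m`. -/
def rotatePolynomial (m : ℕ) (θ : ℝ) (P : ℂ[X]) : ℂ[X] :=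
  C (Complex.exp ((m : ℂ) * (θ : ℂ) * Complex.I)) *
    P.comp (C (Complex.exp (-(θ : ℂ) * Complex.I)) * X)

end

/-! Let K be the closed set of arguments where |P| ≤ h, and measure it by an explicit function
instead of the Green function. The Herglotz transform H of the indicator of K has |Re H| ≤ 1 off K,
so W = exp(iπH/2) (`halfPlaneMap`) lies in the closed right half plane. It equals q = exp(i|K|/4) at
0 and tends to 1/q at infinity. Hence, for |K| < 2π, B = (W - 1/q)/(W + q) (`discMap`) is bounded by
1, vanishes at infinity, and has |B(0)| = sin(|K|/4).

Since P is self-reciprocal, on K the roots x, y of w² - (2P/h)w + P(0)z^m are unimodular. The power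
sums x^k + y^k are polynomials of degree at most mk bounded by 2 on K, so a Bernstein–Walsh argument
with |B| (`norm_eval_mul_discMap_pow_le`) and k → ∞ give |x||B|^m ≤ 1 wherever |y| < |x|
(`norm_mul_norm_discMap_pow_le_one`). At z = 0 this reads (2/h) sin^m(|K|/4) ≤ 1, that is |K| ≤ 2α.
The Maergoiz–Rybakova polynomials attain the bound, because on the circle they are Chebyshev
polynomials in sin(t/2)/sin(α/2) (`norm_eval_mrPolynomial`).

For uniqueness, equality at 0 forces x·B^m to be constant near 0, which gives an algebraic relation
between P and B off K (`exists_quadratic_relation`). Reflecting it in the circle shows that the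
reflected map is B* = czB with |c| = 1 (`exists_discMapReflected_eq`). This is a quadratic equation
for W, so c and α determine W, B and P near 0, and a rotation changes c into any other unimodular
number. -/

/-! ### The Herglotz transform of a compact set of arguments -/

/-- The subset of the unit circle with arguments in `K`. -/
def circleImage (K : Set ℝ) : Set ℂ := (fun t : ℝ => Complex.exp ((t : ℂ) * Complex.I)) '' K

/-- The Herglotz transform of the indicator function of a set of arguments. -/
noncomputable def herglotz (K : Set ℝ) (z : ℂ) : ℂ :=
  (2 * π : ℂ)⁻¹ * ∫ t in K, (Complex.exp ((t : ℂ) * Complex.I) + z) /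
    (Complex.exp ((t : ℂ) * Complex.I) - z)

theorem isCompact_circleImage {K : Set ℝ} (hK : IsCompact K) : IsCompact (circleImage K) :=
  hK.image (by fun_prop)

theorem norm_eq_one_of_mem_circleImage {K : Set ℝ} {z : ℂ} (hz : z ∈ circleImage K) : ‖z‖ = 1 := by
  obtain ⟨t, -, rfl⟩ := hz
  simp [Complex.norm_exp_ofReal_mul_I]

theorem notMem_circleImage_of_norm_ne_one {K : Set ℝ} {z : ℂ} (hz : ‖z‖ ≠ 1) :
    z ∉ circleImage K := fun h => hz (norm_eq_one_of_mem_circleImage h)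

theorem exp_sub_ne_zero {K : Set ℝ} {z : ℂ} (hz : z ∉ circleImage K) {t : ℝ} (ht : t ∈ K) :
    Complex.exp ((t : ℂ) * Complex.I) - z ≠ 0 :=
  fun h => hz ⟨t, ht, sub_eq_zero.1 h⟩

theorem isOpen_compl_circleImage {K : Set ℝ} (hK : IsCompact K) : IsOpen (circleImage K)ᶜ :=
  (isCompact_circleImage hK).isClosed.isOpen_compl

theorem continuousOn_herglotz_kernel {K : Set ℝ} {z : ℂ} (hz : z ∉ circleImage K) :
    ContinuousOn (fun t : ℝ => (Complex.exp ((t : ℂ) * Complex.I) + z) /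
      (Complex.exp ((t : ℂ) * Complex.I) - z)) K :=
  ContinuousOn.div (by fun_prop) (by fun_prop) fun _ ht => exp_sub_ne_zero hz ht

theorem integrableOn_herglotz_kernel {K : Set ℝ} (hK : IsCompact K) {z : ℂ}
    (hz : z ∉ circleImage K) :
    IntegrableOn (fun t : ℝ => (Complex.exp ((t : ℂ) * Complex.I) + z) /
      (Complex.exp ((t : ℂ) * Complex.I) - z)) K :=
  (continuousOn_herglotz_kernel hz).integrableOn_compact hK

theorem differentiableAt_herglotz {K : Set ℝ} (hK : IsCompact K) {z : ℂ}
    (hz : z ∉ circleImage K) : DifferentiableAt ℂ (herglotz K) z := by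
  obtain ⟨d, hd, hsub⟩ := Metric.isOpen_iff.1 (isOpen_compl_circleImage hK) z hz
  have hdist : ∀ t ∈ K, ∀ x ∈ Metric.ball z (d / 2),
      d / 2 ≤ ‖Complex.exp ((t : ℂ) * Complex.I) - x‖ := by
    intro t ht x hx
    by_contra! hlt
    have : Complex.exp ((t : ℂ) * Complex.I) ∈ Metric.ball z d := by
      rw [Metric.mem_ball] at hx ⊢
      have := dist_triangle (Complex.exp ((t : ℂ) * Complex.I)) x z
      rw [dist_eq_norm (Complex.exp ((t : ℂ) * Complex.I)) x] at this
      linarith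
    exact hsub this ⟨t, ht, rfl⟩
  have hball : Metric.ball z (d / 2) ∈ nhds z := Metric.ball_mem_nhds z (by linarith)
  have hne : ∀ t ∈ K, ∀ x ∈ Metric.ball z (d / 2),
      Complex.exp ((t : ℂ) * Complex.I) - x ≠ 0 := fun t ht x hx h0 => by
    have := hdist t ht x hx
    rw [h0, norm_zero] at this
    linarith
  refine DifferentiableAt.const_mul (HasDerivAt.differentiableAt
    (hasDerivAt_integral_of_dominated_loc_of_deriv_le (μ := volume.restrict K)
    (F' := fun x t => 2 * Complex.exp ((t : ℂ) * Complex.I) /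
      (Complex.exp ((t : ℂ) * Complex.I) - x) ^ 2)
    (bound := fun _ => 2 / (d / 2) ^ 2) hball ?_ ?_ ?_ ?_ ?_ ?_).2) _
  · filter_upwards [hball] with x hx
    exact (ContinuousOn.div (by fun_prop) (by fun_prop)
      fun t ht => hne t ht x hx).aestronglyMeasurable hK.measurableSet
  · exact integrableOn_herglotz_kernel hK hz
  · exact (ContinuousOn.div (by fun_prop) (by fun_prop) fun t ht => pow_ne_zero 2
      (hne t ht z (Metric.mem_ball_self (by linarith)))).aestronglyMeasurable hK.measurableSet
  · refine (ae_restrict_iff' hK.measurableSet).2 (Filter.Eventually.of_forall fun t ht x hx => ?_)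
    rw [norm_div, norm_mul, Complex.norm_exp_ofReal_mul_I, norm_pow]
    simp only [Complex.norm_ofNat, mul_one]
    gcongr
    exact hdist t ht x hx
  · exact integrableOn_const hK.measure_lt_top.ne
  · refine (ae_restrict_iff' hK.measurableSet).2 (Filter.Eventually.of_forall fun t ht x hx => ?_)
    have h1 : HasDerivAt (fun x : ℂ => Complex.exp ((t : ℂ) * Complex.I) + x) 1 x :=
      (hasDerivAt_id x).const_add _
    have h2 : HasDerivAt (fun x : ℂ => Complex.exp ((t : ℂ) * Complex.I) - x) (-1) x :=
      (hasDerivAt_id x).const_sub _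
    convert! h1.div h2 (hne t ht x hx) using 1
    ring

theorem herglotz_zero (K : Set ℝ) : herglotz K 0 = ((volume.real K / (2 * π) : ℝ) : ℂ) := by
  simp only [herglotz, add_zero, sub_zero]
  rw [integral_congr_ae (g := fun _ => (1 : ℂ)) (Filter.Eventually.of_forall fun t =>
    div_self (Complex.exp_ne_zero _))]
  simp
  ring

/-- On the circle conj e = 1/e, so the kernel (e + z)/(e - z) turns into minus its conjugate under z
↦ 1/conj z. Facts proved inside the disc thus carry over to the outside and to infinity. -/
theorem herglotz_reflect (K : Set ℝ) {z : ℂ} (hz : z ≠ 0) :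
    herglotz K ((starRingEnd ℂ) z)⁻¹ = -(starRingEnd ℂ) (herglotz K z) := by
  simp only [herglotz, map_mul, map_inv₀, ← integral_conj, ← mul_neg, ← integral_neg]
  congr 1
  · rw [map_ofNat, Complex.conj_ofReal]
  · refine integral_congr_ae (Filter.Eventually.of_forall fun t => ?_)
    have h1 : (starRingEnd ℂ) (Complex.exp ((t : ℂ) * Complex.I)) =
        (Complex.exp ((t : ℂ) * Complex.I))⁻¹ := by
      rw [← Complex.exp_conj, ← Complex.exp_neg]
      simp
    have h3 := Complex.exp_ne_zero ((t : ℂ) * Complex.I)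
    have h2 : (starRingEnd ℂ) z ≠ 0 := by simpa using hz
    simp only [map_div₀, map_add, map_sub, h1]
    generalize Complex.exp ((t : ℂ) * Complex.I) = e at *
    generalize (starRingEnd ℂ) z = w at *
    rw [show e + w⁻¹ = (e * w + 1) / w by field_simp, show e - w⁻¹ = (e * w - 1) / w by field_simp,
      show e⁻¹ + w = (e * w + 1) / e by field_simp; ring,
      show e⁻¹ - w = -((e * w - 1) / e) by field_simp; ring, div_neg, neg_neg,
      div_div_div_cancel_right₀ h2, div_div_div_cancel_right₀ h3]

theorem re_herglotz_kernel {z : ℂ} (t : ℝ) :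
    ((Complex.exp ((t : ℂ) * Complex.I) + z) / (Complex.exp ((t : ℂ) * Complex.I) - z)).re =
      (1 - ‖z‖ ^ 2) / ‖Complex.exp ((t : ℂ) * Complex.I) - z‖ ^ 2 := by
  have := congrFun (poissonKernel_eq_re_herglotzRieszKernel (c := 0) (w := z))
    (Complex.exp ((t : ℂ) * Complex.I))
  simp only [poissonKernel, Function.comp_apply, herglotzRieszKernel, sub_zero,
    Complex.norm_exp_ofReal_mul_I, one_pow] at this
  exact this.symm

theorem re_herglotz {K : Set ℝ} (hK : IsCompact K) {z : ℂ} (hz : z ∉ circleImage K) :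
    (herglotz K z).re = (2 * π)⁻¹ *
      ∫ t in K, (1 - ‖z‖ ^ 2) / ‖Complex.exp ((t : ℂ) * Complex.I) - z‖ ^ 2 := by
  have h1 := Complex.reCLM.integral_comp_comm (integrableOn_herglotz_kernel hK hz)
  simp only [Complex.reCLM_apply, re_herglotz_kernel] at h1
  rw [h1, herglotz, show (2 * π : ℂ)⁻¹ = (((2 * π)⁻¹ : ℝ) : ℂ) by push_cast; rfl,
    Complex.re_ofReal_mul]

/-- The real part is the Poisson integral of the indicator of K: the Poisson kernel is positive and
its mean over the whole circle is 1. -/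
theorem re_herglotz_mem_Icc_of_norm_lt_one {K : Set ℝ} (hK : IsCompact K)
    (hsub : K ⊆ Icc 0 (2 * π)) {z : ℂ} (hz : ‖z‖ < 1) : (herglotz K z).re ∈ Icc 0 1 := by
  rw [re_herglotz hK (notMem_circleImage_of_norm_ne_one hz.ne)]
  have hnn : ∀ t : ℝ, 0 ≤ (1 - ‖z‖ ^ 2) / ‖Complex.exp ((t : ℂ) * Complex.I) - z‖ ^ 2 := fun t =>
    div_nonneg (by nlinarith [norm_nonneg z]) (by positivity)
  have hpi : (0 : ℝ) ≤ (2 * π)⁻¹ := by positivity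
  refine ⟨mul_nonneg hpi (integral_nonneg hnn), ?_⟩
  have hfull : (2 * π)⁻¹ * ∫ t in Icc 0 (2 * π),
      (1 - ‖z‖ ^ 2) / ‖Complex.exp ((t : ℂ) * Complex.I) - z‖ ^ 2 = 1 := by
    have h := DiffContOnCl.circleAverage_poissonKernel_smul (E := ℂ) (f := fun _ => (1 : ℂ))
      (c := 0) (R := 1) (w := z) diffContOnCl_const (by simpa using hz)
    rw [circleAverage_def] at h
    simp only [poissonKernel, circleMap, Pi.smul_apply', sub_zero, zero_add, Complex.ofReal_one,
      one_mul, Complex.norm_exp_ofReal_mul_I, one_pow, Complex.real_smul, mul_one] at h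
    rw [integral_Icc_eq_integral_Ioc, ← intervalIntegral.integral_of_le (by positivity)]
    rw [intervalIntegral.integral_ofReal] at h
    exact_mod_cast h
  refine le_trans (mul_le_mul_of_nonneg_left (setIntegral_mono_set ?_
    (Filter.Eventually.of_forall hnn) (LE.le.eventuallyLE hsub)) hpi) hfull.le
  have hI := (integrableOn_herglotz_kernel (K := Icc 0 (2 * π)) isCompact_Icc
    (notMem_circleImage_of_norm_ne_one hz.ne)).re
  simpa only [RCLike.re_eq_complex_re, re_herglotz_kernel, IntegrableOn] using hI

theorem abs_re_herglotz_le_one {K : Set ℝ} (hK : IsCompact K)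
    (hsub : K ⊆ Icc 0 (2 * π)) {z : ℂ} (hz : z ∉ circleImage K) : |(herglotz K z).re| ≤ 1 := by
  rcases lt_trichotomy ‖z‖ 1 with h | h | h
  · have := re_herglotz_mem_Icc_of_norm_lt_one hK hsub h
    exact abs_le.2 ⟨by linarith [this.1], this.2⟩
  · rw [re_herglotz hK hz, h]
    simp
  · have hz0 : z ≠ 0 := by
      rintro rfl
      simp at h
      linarith
    have hinv : ‖((starRingEnd ℂ) z)⁻¹‖ < 1 := by
      rw [norm_inv, RCLike.norm_conj]
      exact inv_lt_one_of_one_lt₀ h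
    have := re_herglotz_mem_Icc_of_norm_lt_one hK hsub hinv
    rw [herglotz_reflect K hz0] at this
    simp only [Complex.neg_re, Complex.conj_re] at this
    exact abs_le.2 ⟨by linarith [this.2], by linarith [this.1]⟩

/-! ### Maps of the complement into the half plane and the disc -/

/-- The map of the complement of a subset of the circle into the right half plane that is given by
the Herglotz transform. -/
noncomputable def halfPlaneMap (K : Set ℝ) (z : ℂ) : ℂ :=
  Complex.exp (Complex.I * ((π / 2 : ℝ) : ℂ) * herglotz K z)

/-- The unimodular number whose argument is a quarter of the measure of `K`. -/
noncomputable def quarterPhase (K : Set ℝ) : ℂ :=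
  Complex.exp (((volume.real K / 4 : ℝ) : ℂ) * Complex.I)

/-- The map of the complement of a subset of the circle into the unit disc that vanishes at
infinity. -/
noncomputable def discMap (K : Set ℝ) (z : ℂ) : ℂ :=
  (halfPlaneMap K z - (quarterPhase K)⁻¹) / (halfPlaneMap K z + quarterPhase K)

/-- The reflection of `discMap`, which vanishes at the origin. -/
noncomputable def discMapReflected (K : Set ℝ) (z : ℂ) : ℂ :=
  (halfPlaneMap K z - quarterPhase K) / (halfPlaneMap K z + (quarterPhase K)⁻¹)

theorem conj_quarterPhase (K : Set ℝ) :
    (starRingEnd ℂ) (quarterPhase K) = (quarterPhase K)⁻¹ := by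
  rw [quarterPhase, ← Complex.exp_conj, ← Complex.exp_neg]
  simp only [map_mul, Complex.conj_ofReal, Complex.conj_I, mul_neg]

theorem quarterPhase_ne_zero (K : Set ℝ) : quarterPhase K ≠ 0 := Complex.exp_ne_zero _

theorem re_quarterPhase (K : Set ℝ) : (quarterPhase K).re = cos (volume.real K / 4) :=
  Complex.exp_ofReal_mul_I_re _

theorem im_quarterPhase (K : Set ℝ) : (quarterPhase K).im = sin (volume.real K / 4) :=
  Complex.exp_ofReal_mul_I_im _

theorem re_inv_quarterPhase (K : Set ℝ) :
    (quarterPhase K)⁻¹.re = cos (volume.real K / 4) := by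
  rw [← conj_quarterPhase, Complex.conj_re, re_quarterPhase]

theorem re_quarterPhase_pos {K : Set ℝ} (hK : volume.real K < 2 * π) :
    0 < cos (volume.real K / 4) :=
  cos_pos_of_mem_Ioo ⟨by linarith [pi_pos, measureReal_nonneg (μ := volume) (s := K)],
    by linarith⟩

theorem halfPlaneMap_zero (K : Set ℝ) : halfPlaneMap K 0 = quarterPhase K := by
  rw [halfPlaneMap, quarterPhase, herglotz_zero]
  congr 1
  push_cast
  field_simp
  ring

theorem halfPlaneMap_reflect (K : Set ℝ) {z : ℂ} (hz : z ≠ 0) :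
    halfPlaneMap K ((starRingEnd ℂ) z)⁻¹ = (starRingEnd ℂ) (halfPlaneMap K z) := by
  rw [halfPlaneMap, halfPlaneMap, herglotz_reflect K hz, ← Complex.exp_conj]
  simp only [map_mul, Complex.conj_I, Complex.conj_ofReal]
  congr 1
  ring

theorem discMap_reflect (K : Set ℝ) {z : ℂ} (hz : z ≠ 0) :
    discMap K ((starRingEnd ℂ) z)⁻¹ = (starRingEnd ℂ) (discMapReflected K z) := by
  rw [discMap, discMapReflected, halfPlaneMap_reflect K hz]
  simp only [map_div₀, map_sub, map_add, map_inv₀, conj_quarterPhase, inv_inv]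

theorem differentiableAt_halfPlaneMap {K : Set ℝ} (hK : IsCompact K) {z : ℂ}
    (hz : z ∉ circleImage K) : DifferentiableAt ℂ (halfPlaneMap K) z :=
  ((differentiableAt_herglotz hK hz).const_mul _).cexp

/-- The argument of the value is (π/2) Re H, which lies in [-π/2, π/2]. -/
theorem re_halfPlaneMap_nonneg {K : Set ℝ} (hK : IsCompact K) (hsub : K ⊆ Icc 0 (2 * π)) {z : ℂ}
    (hz : z ∉ circleImage K) : 0 ≤ (halfPlaneMap K z).re := by
  rw [halfPlaneMap, Complex.exp_re]
  refine mul_nonneg (exp_pos _).le (cos_nonneg_of_mem_Icc ?_)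
  have h := abs_le.1 (abs_re_herglotz_le_one hK hsub hz)
  have : (Complex.I * ((π / 2 : ℝ) : ℂ) * herglotz K z).im = π / 2 * (herglotz K z).re := by
    rw [mul_assoc, Complex.I_mul_im, Complex.re_ofReal_mul]
  rw [this]
  constructor <;> nlinarith [pi_pos]

theorem halfPlaneMap_add_ne_zero {K : Set ℝ} (hK : IsCompact K) (hsub : K ⊆ Icc 0 (2 * π))
    (hlt : volume.real K < 2 * π) {z : ℂ} (hz : z ∉ circleImage K) :
    halfPlaneMap K z + quarterPhase K ≠ 0 := fun h => by
  have := congrArg Complex.re h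
  rw [Complex.add_re, re_quarterPhase, Complex.zero_re] at this
  linarith [re_quarterPhase_pos hlt, re_halfPlaneMap_nonneg hK hsub hz]

theorem halfPlaneMap_add_inv_ne_zero {K : Set ℝ} (hK : IsCompact K) (hsub : K ⊆ Icc 0 (2 * π))
    (hlt : volume.real K < 2 * π) {z : ℂ} (hz : z ∉ circleImage K) :
    halfPlaneMap K z + (quarterPhase K)⁻¹ ≠ 0 := fun h => by
  have := congrArg Complex.re h
  rw [Complex.add_re, re_inv_quarterPhase, Complex.zero_re] at this
  linarith [re_quarterPhase_pos hlt, re_halfPlaneMap_nonneg hK hsub hz]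

theorem differentiableAt_discMap {K : Set ℝ} (hK : IsCompact K) (hsub : K ⊆ Icc 0 (2 * π))
    (hlt : volume.real K < 2 * π) {z : ℂ} (hz : z ∉ circleImage K) :
    DifferentiableAt ℂ (discMap K) z :=
  ((differentiableAt_halfPlaneMap hK hz).sub_const _).div
    ((differentiableAt_halfPlaneMap hK hz).add_const _) (halfPlaneMap_add_ne_zero hK hsub hlt hz)

theorem differentiableAt_discMapReflected {K : Set ℝ} (hK : IsCompact K)
    (hsub : K ⊆ Icc 0 (2 * π)) (hlt : volume.real K < 2 * π) {z : ℂ} (hz : z ∉ circleImage K) :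
    DifferentiableAt ℂ (discMapReflected K) z :=
  ((differentiableAt_halfPlaneMap hK hz).sub_const _).div
    ((differentiableAt_halfPlaneMap hK hz).add_const _)
    (halfPlaneMap_add_inv_ne_zero hK hsub hlt hz)

/-- With W the half plane value and q the phase, |W + q|² - |W - conj q|² = 4 Re W Re q ≥ 0. -/
theorem norm_discMap_le_one {K : Set ℝ} (hK : IsCompact K) (hsub : K ⊆ Icc 0 (2 * π))
    (hlt : volume.real K < 2 * π) {z : ℂ} (hz : z ∉ circleImage K) : ‖discMap K z‖ ≤ 1 := by
  rw [discMap, norm_div]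
  refine div_le_one_of_le₀ ?_ (norm_nonneg _)
  rw [← sq_le_sq₀ (norm_nonneg _) (norm_nonneg _), ← Complex.normSq_eq_norm_sq,
    ← Complex.normSq_eq_norm_sq, ← conj_quarterPhase, Complex.normSq_apply, Complex.normSq_apply]
  simp only [Complex.sub_re, Complex.sub_im, Complex.add_re, Complex.add_im, Complex.conj_re,
    Complex.conj_im, re_quarterPhase]
  nlinarith [mul_nonneg (re_quarterPhase_pos hlt).le (re_halfPlaneMap_nonneg hK hsub hz)]

theorem zero_notMem_circleImage (K : Set ℝ) : (0 : ℂ) ∉ circleImage K :=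
  notMem_circleImage_of_norm_ne_one (by simp)

theorem discMapReflected_zero (K : Set ℝ) : discMapReflected K 0 = 0 := by
  rw [discMapReflected, halfPlaneMap_zero, sub_self, zero_div]

theorem discMap_zero (K : Set ℝ) :
    discMap K 0 = Complex.I * ((sin (volume.real K / 4) : ℝ) : ℂ) * (quarterPhase K)⁻¹ := by
  have h : quarterPhase K - (quarterPhase K)⁻¹ =
      2 * Complex.I * ((sin (volume.real K / 4) : ℝ) : ℂ) := by
    rw [← conj_quarterPhase, Complex.sub_conj, im_quarterPhase]
    push_cast
    ring
  have h0 := quarterPhase_ne_zero K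
  rw [discMap, halfPlaneMap_zero, h]
  field_simp
  ring

theorem norm_quarterPhase (K : Set ℝ) : ‖quarterPhase K‖ = 1 := Complex.norm_exp_ofReal_mul_I _

theorem norm_discMap_zero {K : Set ℝ} (hlt : volume.real K < 2 * π) :
    ‖discMap K 0‖ = sin (volume.real K / 4) := by
  rw [discMap_zero, norm_mul, norm_mul, norm_inv, norm_quarterPhase, Complex.norm_I,
    Complex.norm_real, norm_eq_abs, abs_of_nonneg]
  · ring
  · exact sin_nonneg_of_nonneg_of_le_pi (by positivity) (by linarith [pi_pos])

/-- `discMap` decays like `1 / z` at infinity. -/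
theorem isBigO_discMap {K : Set ℝ} (hK : IsCompact K) (hsub : K ⊆ Icc 0 (2 * π))
    (hlt : volume.real K < 2 * π) :
    discMap K =O[Bornology.cobounded ℂ] fun z => z⁻¹ := by
  -- Reflection turns a zero at the origin into decay at infinity.
  have h0 : discMapReflected K =O[nhds 0] fun z => z := by
    have := (differentiableAt_discMapReflected hK hsub hlt (zero_notMem_circleImage K)).isBigO_sub
    simpa [discMapReflected_zero] using this
  have ht : Filter.Tendsto (fun z : ℂ => ((starRingEnd ℂ) z)⁻¹) (Bornology.cobounded ℂ)
      (nhds 0) := by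
    have h1 := Filter.tendsto_inv₀_cobounded (α := ℂ)
    have h2 := (Complex.continuous_conj.tendsto 0).comp h1
    simpa [Function.comp_def] using h2
  refine ((h0.comp_tendsto ht).norm_norm.congr' ?_ ?_).of_norm_norm
  · filter_upwards [Bornology.eventually_ne_cobounded 0] with z hz
    have h3 : ((starRingEnd ℂ) z)⁻¹ ≠ 0 := by simpa using hz
    have h4 := discMap_reflect K h3
    rw [map_inv₀, Complex.conj_conj, inv_inv] at h4
    rw [h4, RCLike.norm_conj, Function.comp_apply]
  · filter_upwards with z
    simp

/-! ### Maximum principle and a Bernstein–Walsh inequality -/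

/-- Maximum principle: a holomorphic function on an open subset of the plane whose superlevel sets
for levels above `M` are compact is bounded by `M`. -/
theorem norm_le_of_isCompact_superlevel {U : Set ℂ} (hU : IsOpen U) {F : ℂ → ℂ}
    (hF : ∀ z ∈ U, DifferentiableAt ℂ F z) {M : ℝ}
    (hc : ∀ c > M, IsCompact {z | z ∈ U ∧ c ≤ ‖F z‖}) {z : ℂ} (hz : z ∈ U) : ‖F z‖ ≤ M := by
  by_contra! hlt
  have hcont : ContinuousOn (fun z => ‖F z‖) U := fun w hw =>
    (hF w hw).continuousAt.norm.continuousWithinAt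
  obtain ⟨w, hw, hmax⟩ := (hc _ hlt).exists_isMaxOn ⟨z, hz, le_rfl⟩
    (hcont.mono fun _ h => h.1)
  have hmax' : ∀ x ∈ U, ‖F x‖ ≤ ‖F w‖ := fun x hx => by
    by_cases h : ‖F z‖ ≤ ‖F x‖
    · exact hmax ⟨hx, h⟩
    · exact (not_le.1 h).le.trans hw.2
  have hcomp := hc ‖F w‖ (hlt.trans_le hw.2)
  -- The set where the maximum is attained is open by the local maximum principle and compact by
  -- hypothesis, hence a nonempty clopen subset of the plane, which is not compact.
  have hopen : IsOpen {x | x ∈ U ∧ ‖F w‖ ≤ ‖F x‖} := by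
    refine isOpen_iff_mem_nhds.2 fun x hx => ?_
    have hev : ∀ᶠ y in nhds x, y ∈ U := hU.mem_nhds hx.1
    have := Complex.eventually_eq_of_isLocalMax_norm (hev.mono hF)
      (hev.mono fun y hy => (hmax' y hy).trans hx.2)
    filter_upwards [hev, this] with y hy hy'
    exact ⟨hy, by rw [hy']; exact hx.2⟩
  have huniv := IsClopen.eq_univ ⟨hcomp.isClosed, hopen⟩ ⟨w, hw.1, le_rfl⟩
  rw [huniv] at hcomp
  exact noncompact_univ ℂ hcomp

/-- Here |B| replaces exp(-g), with g the Green function with pole at infinity. The exponent N + 1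
rather than N makes the product tend to 0 at infinity, so that its superlevel sets are bounded; the
extra factor is harmless once N → ∞. -/
theorem norm_eval_mul_discMap_pow_le {K : Set ℝ} (hK : IsCompact K) (hsub : K ⊆ Icc 0 (2 * π))
    (hlt : volume.real K < 2 * π) {A : ℂ[X]} {N : ℕ} (hA : A.natDegree ≤ N) {M : ℝ} (hM0 : 0 ≤ M)
    (hM : ∀ z ∈ circleImage K, ‖A.eval z‖ ≤ M) {z : ℂ} (hz : z ∉ circleImage K) :
    ‖A.eval z‖ * ‖discMap K z‖ ^ (N + 1) ≤ M := by
  have hd : ∀ w ∈ (circleImage K)ᶜ,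
      DifferentiableAt ℂ (fun w => A.eval w * discMap K w ^ (N + 1)) w := fun w hw =>
    A.differentiableAt.mul ((differentiableAt_discMap hK hsub hlt hw).pow _)
  have hinf : Filter.Tendsto (fun w => A.eval w * discMap K w ^ (N + 1))
      (Bornology.cobounded ℂ) (nhds 0) := by
    have h1 : (fun w => A.eval w) =O[Bornology.cobounded ℂ] fun w => w ^ N := by
      have h1 : (fun w => A.eval w) =
          fun w => ∑ i ∈ Finset.range (N + 1), A.coeff i * w ^ i := by
        ext w
        exact eval_eq_sum_range' (Nat.lt_succ_of_le hA) w
      rw [h1]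
      refine Asymptotics.IsBigO.fun_sum fun i hi =>
        Asymptotics.IsBigO.const_mul_left (f := fun w => w ^ i) ?_ _
      refine Asymptotics.IsBigO.of_bound 1 ?_
      have : ∀ᶠ w : ℂ in Bornology.cobounded ℂ, 1 ≤ ‖w‖ :=
        tendsto_norm_cobounded_atTop.eventually_ge_atTop 1
      filter_upwards [this] with w hw
      rw [one_mul, norm_pow, norm_pow]
      exact pow_le_pow_right₀ hw (Nat.lt_succ_iff.1 (Finset.mem_range.1 hi))
    have h2 := h1.mul ((isBigO_discMap hK hsub hlt).pow (N + 1))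
    refine (h2.congr' (Filter.EventuallyEq.refl _ _) ?_).trans_tendsto
      (Filter.tendsto_inv₀_cobounded (α := ℂ))
    filter_upwards [Bornology.eventually_ne_cobounded 0] with w hw
    rw [inv_pow, pow_succ, mul_inv, ← mul_assoc, mul_inv_cancel₀ (pow_ne_zero _ hw), one_mul]
  have key := norm_le_of_isCompact_superlevel (isOpen_compl_circleImage hK) hd (M := M) ?_ hz
  · simpa only [norm_mul, norm_pow] using key
  intro c hc
  have hb : Bornology.IsBounded {w | w ∈ (circleImage K)ᶜ ∧
      c ≤ ‖A.eval w * discMap K w ^ (N + 1)‖} := by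
    have h1 : ∀ᶠ w in Bornology.cobounded ℂ, ‖A.eval w * discMap K w ^ (N + 1)‖ < c :=
      hinf.norm.eventually_lt_const (by simpa using hM0.trans_lt hc)
    rw [← Bornology.isCobounded_compl_iff]
    filter_upwards [h1] with w hw hmem
    exact hw.not_ge hmem.2
  refine Metric.isCompact_of_isClosed_isBounded ?_ hb
  rw [← isOpen_compl_iff]
  refine isOpen_iff_mem_nhds.2 fun w hw => ?_
  -- Nothing is known about B on K itself; near such a point, |B| ≤ 1 off K and continuity of A
  -- suffice.
  by_cases hwK : w ∈ circleImage K
  · have h1 : ∀ᶠ x in nhds w, ‖A.eval x‖ < c :=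
      A.continuous.norm.continuousAt.eventually_lt_const ((hM w hwK).trans_lt hc)
    filter_upwards [h1] with x hx hmem
    refine (hmem.2.trans ?_).not_gt hx
    rw [norm_mul, norm_pow]
    exact mul_le_of_le_one_right (norm_nonneg _)
      (pow_le_one₀ (norm_nonneg _) (norm_discMap_le_one hK hsub hlt hmem.1))
  · have h1 : ‖A.eval w * discMap K w ^ (N + 1)‖ < c := by
      by_contra! h
      exact hw ⟨hwK, h⟩
    filter_upwards [(hd w hwK).continuousAt.norm.eventually_lt_const h1] with x hx hmem
    exact hx.not_ge hmem.2

/-! ### Self-reciprocity and power sums of the roots -/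

theorem natDegree_of_mem_circlePolynomials {m : ℕ} {P : ℂ[X]} (hP : P ∈ circlePolynomials m) :
    P.natDegree = m := by
  obtain ⟨φ, rfl⟩ := hP
  rw [natDegree_prod_of_monic _ _ fun i _ => monic_X_sub_C (Complex.exp ((φ i : ℂ) * Complex.I))]
  simp

theorem norm_eval_zero_of_mem_circlePolynomials {m : ℕ} {P : ℂ[X]}
    (hP : P ∈ circlePolynomials m) : ‖P.eval 0‖ = 1 := by
  obtain ⟨φ, rfl⟩ := hP
  simp [eval_prod, norm_prod, Complex.norm_exp_ofReal_mul_I]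

/-- A polynomial with all zeros on the unit circle is self-reciprocal. -/
theorem eval_eq_reflect_of_mem_circlePolynomials {m : ℕ} {P : ℂ[X]}
    (hP : P ∈ circlePolynomials m) {z : ℂ} (hz : z ≠ 0) :
    P.eval z = P.eval 0 * z ^ m * (starRingEnd ℂ) (P.eval ((starRingEnd ℂ) z)⁻¹) := by
  obtain ⟨φ, rfl⟩ := hP
  simp only [eval_prod, eval_sub, eval_X, eval_C, map_prod, map_sub, map_inv₀, Complex.conj_conj]
  have : z ^ m = ∏ _j : Fin m, z := by simp
  rw [this, ← Finset.prod_mul_distrib, ← Finset.prod_mul_distrib]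
  refine Finset.prod_congr rfl fun j _ => ?_
  have h1 : (starRingEnd ℂ) (Complex.exp ((φ j : ℂ) * Complex.I)) =
      (Complex.exp ((φ j : ℂ) * Complex.I))⁻¹ := by
    rw [← Complex.exp_conj, ← Complex.exp_neg]
    simp
  have := Complex.exp_ne_zero ((φ j : ℂ) * Complex.I)
  rw [h1]
  field_simp
  ring

/-- On the circle, P divided by a square root of P(0)z^m is therefore real. -/
theorem eval_sq_of_mem_circlePolynomials {m : ℕ} {P : ℂ[X]}
    (hP : P ∈ circlePolynomials m) {z : ℂ} (hz : ‖z‖ = 1) :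
    P.eval z ^ 2 = P.eval 0 * z ^ m * ((‖P.eval z‖ ^ 2 : ℝ) : ℂ) := by
  have hz0 : z ≠ 0 := norm_pos_iff.1 (by rw [hz]; exact one_pos)
  have h1 : ((starRingEnd ℂ) z)⁻¹ = z := by
    rw [← map_inv₀, Complex.inv_eq_conj hz, Complex.conj_conj]
  have h2 := eval_eq_reflect_of_mem_circlePolynomials hP hz0
  rw [h1] at h2
  rw [Complex.ofReal_pow, ← Complex.conj_mul']
  nth_rewrite 1 [sq, h2]
  ring

/-- The polynomials `x ^ k + y ^ k`, where `x` and `y` are the roots of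
`w ^ 2 - (2 P / h) w + P(0) z ^ m`. -/
noncomputable def rootPowerSum (m : ℕ) (h : ℝ) (P : ℂ[X]) : ℕ → ℂ[X]
  | 0 => C 2
  | 1 => C (2 / h : ℂ) * P
  | k + 2 => C (2 / h : ℂ) * P * rootPowerSum m h P (k + 1) -
      C (P.eval 0) * X ^ m * rootPowerSum m h P k

theorem eval_rootPowerSum {m : ℕ} {h : ℝ} {P : ℂ[X]} {z x y : ℂ}
    (hadd : x + y = 2 / h * P.eval z) (hmul : x * y = P.eval 0 * z ^ m) (k : ℕ) :
    (rootPowerSum m h P k).eval z = x ^ k + y ^ k := by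
  induction k using Nat.twoStepInduction with
  | zero => simp [rootPowerSum]; norm_num
  | one => simp [rootPowerSum, hadd]
  | more k h1 h2 =>
    simp only [rootPowerSum, eval_sub, eval_mul, eval_C, eval_pow, eval_X, h1, h2, ← hadd, ← hmul]
    ring

theorem natDegree_rootPowerSum_le {m : ℕ} {h : ℝ} {P : ℂ[X]} (hP : P.natDegree ≤ m) (k : ℕ) :
    (rootPowerSum m h P k).natDegree ≤ m * k := by
  induction k using Nat.twoStepInduction with
  | zero => simp [rootPowerSum]
  | one => simpa [rootPowerSum] using (natDegree_C_mul_le _ _).trans hP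
  | more k h1 h2 =>
    rw [rootPowerSum]
    refine (natDegree_sub_le _ _).trans (max_le ?_ ?_)
    · refine natDegree_mul_le.trans ?_
      have := (natDegree_C_mul_le (2 / h : ℂ) P).trans hP
      nlinarith
    · refine natDegree_mul_le.trans ?_
      have := natDegree_C_mul_X_pow_le (P.eval 0) m
      nlinarith

/-- Write P(0)z^m = ω² and P(z) = ωh cos φ. The two roots are ω exp(±iφ), so the power sum is 2ω^k
cos kφ, a Chebyshev polynomial in disguise. -/
theorem norm_eval_rootPowerSum_le {m : ℕ} {h : ℝ} (h_pos : 0 < h) {P : ℂ[X]}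
    (hP : P ∈ circlePolynomials m) {z : ℂ} (hz : ‖z‖ = 1) (hle : ‖P.eval z‖ ≤ h) (k : ℕ) :
    ‖(rootPowerSum m h P k).eval z‖ ≤ 2 := by
  obtain ⟨ω, hω⟩ := IsSquare.exists_sq _ (Complex.isSquare (P.eval 0 * z ^ m))
  have hω1 : ‖ω‖ = 1 := by
    have := congrArg norm hω
    rw [norm_mul, norm_pow, norm_pow, hz, norm_eval_zero_of_mem_circlePolynomials hP] at this
    simp only [one_pow, mul_one] at this
    exact (pow_eq_one_iff_of_nonneg (norm_nonneg ω) two_ne_zero).1 this.symm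
  have hω0 : ω ≠ 0 := norm_pos_iff.1 (by rw [hω1]; exact one_pos)
  obtain ⟨q, hq, hPq⟩ : ∃ q : ℝ, |q| ≤ h ∧ P.eval z = ω * q := by
    have h1 := eval_sq_of_mem_circlePolynomials hP hz
    rw [hω, Complex.ofReal_pow, ← mul_pow, sq_eq_sq_iff_eq_or_eq_neg] at h1
    rcases h1 with h1 | h1
    · exact ⟨‖P.eval z‖, by rwa [abs_norm], h1⟩
    · exact ⟨-‖P.eval z‖, by rwa [abs_neg, abs_norm], by rw [Complex.ofReal_neg, mul_neg]; exact h1⟩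
  set φ := arccos (q / h)
  have hcos : ((cos φ : ℝ) : ℂ) = q / h := by
    rw [cos_arccos, Complex.ofReal_div]
    · rw [le_div_iff₀ h_pos]
      linarith [(abs_le.1 hq).1]
    · rw [div_le_one h_pos]
      exact (abs_le.1 hq).2
  have h0 : (h : ℂ) ≠ 0 := by exact_mod_cast h_pos.ne'
  rw [Complex.ofReal_cos, Complex.cos] at hcos
  rw [eval_rootPowerSum (x := ω * Complex.exp (φ * Complex.I))
    (y := ω * Complex.exp (-φ * Complex.I))]
  · refine (norm_add_le _ _).trans ?_
    rw [show (-φ : ℂ) = ((-φ : ℝ) : ℂ) by push_cast; rfl]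
    simp only [norm_pow, norm_mul, hω1, Complex.norm_exp_ofReal_mul_I, one_pow, mul_one]
    norm_num
  · rw [hPq, ← mul_add]
    rw [div_eq_iff two_ne_zero] at hcos
    rw [hcos]
    field_simp
  · rw [hω, neg_mul, Complex.exp_neg]
    field_simp [Complex.exp_ne_zero]

/-- Since |y| < |x|, the power sum is at least |x|^k/2 for large k, so |x||B|^m > 1 would make the
bounded quantity |x^k + y^k||B|^(mk+1) grow geometrically. -/
theorem norm_mul_norm_discMap_pow_le_one {m : ℕ} (hm : m ≠ 0) {h : ℝ} (h_pos : 0 < h) {P : ℂ[X]}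
    (hP : P ∈ circlePolynomials m) {K : Set ℝ} (hK : IsCompact K) (hsub : K ⊆ Icc 0 (2 * π))
    (hlt : volume.real K < 2 * π) (hle : ∀ z ∈ circleImage K, ‖P.eval z‖ ≤ h)
    {z : ℂ} (hz : z ∉ circleImage K) {x y : ℂ} (hadd : x + y = 2 / h * P.eval z)
    (hmul : x * y = P.eval 0 * z ^ m) (hxy : ‖y‖ < ‖x‖) : ‖x‖ * ‖discMap K z‖ ^ m ≤ 1 := by
  by_contra! hgt
  have hx : 0 < ‖x‖ := (norm_nonneg y).trans_lt hxy
  have hb : 0 < ‖discMap K z‖ := by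
    rcases (norm_nonneg (discMap K z)).eq_or_lt with h0 | h0
    · rw [← h0, zero_pow hm, mul_zero] at hgt
      exact absurd hgt (by norm_num)
    · exact h0
  have hkey : ∀ k, ‖x ^ k + y ^ k‖ * ‖discMap K z‖ ^ (m * k + 1) ≤ 2 := fun k => by
    have := norm_eval_mul_discMap_pow_le hK hsub hlt
      (natDegree_rootPowerSum_le (h := h) (natDegree_of_mem_circlePolynomials hP).le k)
      zero_le_two (fun w hw => norm_eval_rootPowerSum_le h_pos hP
        (norm_eq_one_of_mem_circleImage hw) (hle w hw) k) hz
    rwa [eval_rootPowerSum hadd hmul] at this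
  have hr : Filter.Tendsto (fun k : ℕ => (‖y‖ / ‖x‖) ^ k) Filter.atTop (nhds 0) :=
    tendsto_pow_atTop_nhds_zero_of_lt_one (by positivity) ((div_lt_one hx).2 hxy)
  have hq := tendsto_pow_atTop_atTop_of_one_lt hgt
  obtain ⟨k, hk1, hk2⟩ := ((hr.eventually_lt_const (show (0 : ℝ) < 1 / 2 by norm_num)).and
    (hq.eventually_gt_atTop (4 / ‖discMap K z‖))).exists
  have h1 : ‖x‖ ^ k / 2 ≤ ‖x ^ k + y ^ k‖ := by
    have h2 : ‖x‖ ^ k - ‖y‖ ^ k ≤ ‖x ^ k + y ^ k‖ := by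
      rw [← norm_pow, ← norm_pow]
      exact norm_sub_le_norm_add _ _
    rw [div_pow, div_lt_iff₀ (by positivity)] at hk1
    linarith
  have h3 := hkey k
  rw [div_lt_iff₀ hb, mul_pow, ← pow_mul] at hk2
  have h4 := mul_le_mul_of_nonneg_right h1 (pow_nonneg hb.le (m * k + 1))
  rw [pow_succ] at h3 h4
  nlinarith

/-! ### The bound for the measure of the sublevel set -/

theorem isCompact_sublevel (P : ℂ[X]) (h b : ℝ) :
    IsCompact {t : ℝ | t ∈ Icc 0 b ∧ ‖P.eval (Complex.exp ((t : ℂ) * Complex.I))‖ ≤ h} := by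
  refine isCompact_Icc.inter_right (t := {t : ℝ | ‖P.eval (Complex.exp ((t : ℂ) * Complex.I))‖ ≤ h})
    (isClosed_le ?_ continuous_const)
  exact (P.continuous.comp (by fun_prop)).norm

/-- At the origin the roots are 2P(0)/h and 0, and |P(0)| = 1. -/
theorem two_div_mul_sin_pow_le_one {m : ℕ} (hm : m ≠ 0) {h : ℝ} (h_pos : 0 < h) {P : ℂ[X]}
    (hP : P ∈ circlePolynomials m) {K : Set ℝ} (hK : IsCompact K) (hsub : K ⊆ Icc 0 (2 * π))
    (hlt : volume.real K < 2 * π) (hle : ∀ z ∈ circleImage K, ‖P.eval z‖ ≤ h) :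
    2 / h * sin (volume.real K / 4) ^ m ≤ 1 := by
  have h1 := norm_eval_zero_of_mem_circlePolynomials hP
  have hn : ‖2 / (h : ℂ) * P.eval 0‖ = 2 / h := by
    rw [norm_mul, h1, norm_div, Complex.norm_real, norm_eq_abs, abs_of_pos h_pos]
    simp
  have := norm_mul_norm_discMap_pow_le_one hm h_pos hP hK hsub hlt hle
    (zero_notMem_circleImage K) (x := 2 / h * P.eval 0) (y := 0) (by ring) (by simp [hm])
    (by rw [hn, norm_zero]; positivity)
  rwa [hn, norm_discMap_zero hlt] at this

/-- The set of arguments at which a polynomial with all zeros on the circle has modulus at most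
`2 sin ^ m (α / 2)` has measure at most `2 α`. -/
theorem measureReal_sublevel_le {m : ℕ} (hm : m ≠ 0) {α : ℝ} (hα : α ∈ Ioo 0 π) {P : ℂ[X]}
    (hP : P ∈ circlePolynomials m) :
    volume.real {t : ℝ | t ∈ Icc 0 (2 * π) ∧
      ‖P.eval (Complex.exp ((t : ℂ) * Complex.I))‖ ≤ 2 * sin (α / 2) ^ m} ≤ 2 * α := by
  have hs : 0 < sin (α / 2) := sin_pos_of_pos_of_lt_pi (by linarith [hα.1]) (by linarith [hα.2, pi_pos])
  set h := 2 * sin (α / 2) ^ m with hh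
  have h_pos : 0 < h := by positivity
  by_contra! hgt
  set E := {t : ℝ | t ∈ Icc 0 (2 * π) ∧
      ‖P.eval (Complex.exp ((t : ℂ) * Complex.I))‖ ≤ h} with hE
  -- The sublevel set could a priori have full measure, where the disc map degenerates. Cutting off
  -- an interval of length half the excess leaves measure below 2π but still above 2α.
  obtain ⟨η, hη⟩ : ∃ η, η = (volume.real E - 2 * α) / 2 := ⟨_, rfl⟩
  have hη0 : 0 < η := by linarith
  set K := {t : ℝ | t ∈ Icc 0 (2 * π - η) ∧
      ‖P.eval (Complex.exp ((t : ℂ) * Complex.I))‖ ≤ h} with hKdef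
  have hK : IsCompact K := isCompact_sublevel P h _
  have hEle : volume.real E ≤ volume.real K + η := by
    have h1 : E ⊆ K ∪ Icc (2 * π - η) (2 * π) := by
      intro t ht
      by_cases h : t ≤ 2 * π - η
      · exact Or.inl ⟨⟨ht.1.1, h⟩, ht.2⟩
      · exact Or.inr ⟨(not_le.1 h).le, ht.1.2⟩
    refine (measureReal_mono h1 (hK.union isCompact_Icc).measure_lt_top.ne).trans
      ((measureReal_union_le _ _).trans ?_)
    rw [Real.volume_real_Icc_of_le (by linarith)]
    linarith
  have hE2 : volume.real E ≤ 2 * π := by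
    refine (measureReal_mono (fun t ht => ht.1 : E ⊆ Icc 0 (2 * π))
      isCompact_Icc.measure_lt_top.ne).trans ?_
    rw [Real.volume_real_Icc_of_le (by positivity), sub_zero]
  have hK2 : volume.real K ≤ 2 * π - η := by
    refine (measureReal_mono (fun t ht => ht.1 : K ⊆ Icc 0 (2 * π - η))
      isCompact_Icc.measure_lt_top.ne).trans ?_
    rw [Real.volume_real_Icc_of_le (by linarith [hα.1, hα.2]), sub_zero]
  have key := two_div_mul_sin_pow_le_one hm h_pos hP hK
    (fun t ht => ⟨ht.1.1, by linarith [ht.1.2]⟩) (by linarith)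
    (by rintro z ⟨t, ht, rfl⟩; exact ht.2)
  have hsin : sin (α / 2) < sin (volume.real K / 4) :=
    sin_lt_sin_of_lt_of_le_pi_div_two (by linarith [hα.1, pi_pos]) (by linarith) (by linarith)
  rw [div_mul_eq_mul_div, div_le_one h_pos, hh] at key
  linarith [pow_lt_pow_left₀ hsin hs.le hm]

/-! ### The Maergoiz–Rybakova polynomials -/

theorem mul_mem_circlePolynomials {m n : ℕ} {P Q : ℂ[X]} (hP : P ∈ circlePolynomials m)
    (hQ : Q ∈ circlePolynomials n) : P * Q ∈ circlePolynomials (m + n) := by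
  obtain ⟨φ, rfl⟩ := hP
  obtain ⟨ψ, rfl⟩ := hQ
  exact ⟨Fin.append φ ψ, by simp [Fin.prod_univ_add]⟩

theorem one_mem_circlePolynomials : (1 : ℂ[X]) ∈ circlePolynomials 0 := ⟨fun _ => 0, by simp⟩

theorem X_sub_C_exp_mem_circlePolynomials (φ : ℝ) :
    X - C (Complex.exp ((φ : ℂ) * Complex.I)) ∈ circlePolynomials 1 := ⟨fun _ => φ, by simp⟩

theorem quadratic_mem_circlePolynomials {a : ℝ} (ha : a ∈ Icc (-1) 1) :
    X ^ 2 - C ((2 * a : ℝ) : ℂ) * X + 1 ∈ circlePolynomials 2 := by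
  have h := mul_mem_circlePolynomials (X_sub_C_exp_mem_circlePolynomials (arccos a))
    (X_sub_C_exp_mem_circlePolynomials (-arccos a))
  convert! h using 1
  set e := Complex.exp ((arccos a : ℂ) * Complex.I) with he
  have h1 : Complex.exp (((-arccos a : ℝ) : ℂ) * Complex.I) = e⁻¹ := by
    rw [he, ← Complex.exp_neg]
    congr 1
    push_cast
    ring
  have h2 : ((2 * a : ℝ) : ℂ) = e + e⁻¹ := by
    rw [← h1, he]
    nth_rewrite 1 [← cos_arccos ha.1 ha.2]
    push_cast
    rw [Complex.two_cos]
  have h3 : C e * C e⁻¹ = (1 : ℂ[X]) := by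
    rw [← C_mul, mul_inv_cancel₀ (Complex.exp_ne_zero _), C_1]
  rw [h1, h2, C_add]
  linear_combination -h3

theorem mrCoeff_mem_Icc (k m : ℕ) (α : ℝ) : mrCoeff k m α ∈ Icc (-1) 1 := by
  have h1 := cos_sq_le_one (π * (2 * (k : ℝ) - 1) / (2 * (m : ℝ)))
  have h2 := sin_sq_le_one (α / 2)
  have h3 := sq_nonneg (cos (π * (2 * (k : ℝ) - 1) / (2 * (m : ℝ))))
  have h4 := sq_nonneg (sin (α / 2))
  rw [mrCoeff]
  constructor
  · nlinarith [mul_le_one₀ h1 h4 h2]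
  · nlinarith [mul_nonneg h3 h4]

theorem mrProduct_mem_circlePolynomials (n m : ℕ) (α : ℝ) :
    mrProduct n m α ∈ circlePolynomials (2 * n) := by
  induction n with
  | zero => simpa [mrProduct] using one_mem_circlePolynomials
  | succ n ih =>
    have h := mul_mem_circlePolynomials ih
      (quadratic_mem_circlePolynomials (mrCoeff_mem_Icc (n + 1) m α))
    rw [mrProduct, Finset.prod_Icc_succ_top (by omega)]
    exact h

theorem mrPolynomial_mem_circlePolynomials (m : ℕ) (α : ℝ) :
    mrPolynomial m α ∈ circlePolynomials m := by
  rw [mrPolynomial]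
  split_ifs with he
  · have h := mrProduct_mem_circlePolynomials (m / 2) m α
    rwa [Nat.two_mul_div_two_of_even he] at h
  · have h := mul_mem_circlePolynomials (X_sub_C_exp_mem_circlePolynomials 0)
      (mrProduct_mem_circlePolynomials (m / 2) m α)
    have h1 : 1 + 2 * (m / 2) = m := by
      have := Nat.not_even_iff.1 he
      omega
    rw [h1] at h
    simpa using h

theorem eval_T_real_eq_prod {m : ℕ} (u : ℝ) :
    (Chebyshev.T ℝ m).eval u =
      2 ^ (m - 1) * ∏ k ∈ Finset.range m, (u - cos ((2 * (k : ℝ) + 1) * π / (2 * m))) := by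
  have hroots : (Chebyshev.T ℝ m).roots = (Multiset.range m).map
      fun k : ℕ => cos ((2 * (k : ℝ) + 1) * π / (2 * m)) := by
    rw [Chebyshev.roots_T_real, Finset.image_val, Multiset.dedup_eq_self.2]
    · rfl
    · exact Chebyshev.roots_T_real_nodup m
  have h := C_leadingCoeff_mul_prod_multiset_X_sub_C (p := Chebyshev.T ℝ m) (by
    rw [hroots, Multiset.card_map, Multiset.card_range, Chebyshev.natDegree_T]
    simp)
  rw [hroots, Chebyshev.leadingCoeff_T] at h
  rw [← h, eval_C_mul, eval_multiset_prod, Multiset.map_map, Multiset.map_map]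
  simp [Function.comp_def, Finset.prod]

theorem prod_range_two_mul_of_neg {c : ℕ → ℝ} {n : ℕ} (hc : ∀ k < n, c (2 * n - 1 - k) = -c k)
    (u : ℝ) : ∏ k ∈ Finset.range (2 * n), (u - c k) =
      ∏ k ∈ Finset.range n, (u ^ 2 - c k ^ 2) := by
  rw [two_mul, Finset.prod_range_add, ← Finset.prod_range_reflect (fun k => u - c (n + k)),
    ← Finset.prod_mul_distrib]
  refine Finset.prod_congr rfl fun k hk => ?_
  rw [Finset.mem_range] at hk
  rw [show n + (n - 1 - k) = 2 * n - 1 - k by omega, hc k hk]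
  ring

theorem prod_range_two_mul_add_one_of_neg {c : ℕ → ℝ} {n : ℕ} (h0 : c n = 0)
    (hc : ∀ k < n, c (2 * n - k) = -c k)
    (u : ℝ) : ∏ k ∈ Finset.range (2 * n + 1), (u - c k) =
      u * ∏ k ∈ Finset.range n, (u ^ 2 - c k ^ 2) := by
  rw [two_mul, add_assoc, Finset.prod_range_add, Finset.prod_range_succ', add_zero, h0, sub_zero,
    ← Finset.prod_range_reflect (fun k => u - c (n + (k + 1))), ← mul_assoc,
    ← Finset.prod_mul_distrib, mul_comm]
  congr 1
  refine Finset.prod_congr rfl fun k hk => ?_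
  rw [Finset.mem_range] at hk
  rw [show n + (n - 1 - k + 1) = 2 * n - k by omega, hc k hk]
  ring

theorem norm_exp_sub_one (t : ℝ) :
    ‖Complex.exp ((t : ℂ) * Complex.I) - 1‖ = 2 * |sin (t / 2)| := by
  rw [mul_comm, Complex.norm_exp_I_mul_ofReal_sub_one, norm_mul, norm_eq_abs, norm_eq_abs,
    abs_two]

theorem norm_eval_quadratic (a t : ℝ) :
    ‖(X ^ 2 - C ((2 * a : ℝ) : ℂ) * X + 1 : ℂ[X]).eval (Complex.exp ((t : ℂ) * Complex.I))‖ =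
      2 * |cos t - a| := by
  have h : (X ^ 2 - C ((2 * a : ℝ) : ℂ) * X + 1 : ℂ[X]).eval (Complex.exp ((t : ℂ) * Complex.I)) =
      Complex.exp ((t : ℂ) * Complex.I) * ((2 * (cos t - a) : ℝ) : ℂ) := by
    have h1 : Complex.exp ((t : ℂ) * Complex.I) * Complex.exp (-(t : ℂ) * Complex.I) = 1 := by
      rw [← Complex.exp_add]
      simp
    have h2 := Complex.two_cos (t : ℂ)
    simp only [eval_add, eval_sub, eval_pow, eval_X, eval_mul, eval_C, eval_one]
    push_cast
    linear_combination -Complex.exp ((t : ℂ) * Complex.I) * h2 - h1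
  rw [h, norm_mul, Complex.norm_exp_ofReal_mul_I, one_mul, Complex.norm_real, norm_mul,
    norm_eq_abs, norm_eq_abs, abs_two]

theorem norm_eval_mrProduct (n m : ℕ) {α : ℝ} (hs : 0 < sin (α / 2)) (t : ℝ) :
    ‖(mrProduct n m α).eval (Complex.exp ((t : ℂ) * Complex.I))‖ =
      (4 * sin (α / 2) ^ 2) ^ n * |∏ k ∈ Finset.range n, ((sin (t / 2) / sin (α / 2)) ^ 2 -
        cos ((2 * (k : ℝ) + 1) * π / (2 * m)) ^ 2)| := by
  induction n with
  | zero => simp [mrProduct]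
  | succ n ih =>
    have h1 : mrProduct (n + 1) m α =
        mrProduct n m α * (X ^ 2 - C ((2 * mrCoeff (n + 1) m α : ℝ) : ℂ) * X + 1) :=
      Finset.prod_Icc_succ_top (by omega) _
    have h2 : 2 * |cos t - mrCoeff (n + 1) m α| = 4 * sin (α / 2) ^ 2 *
        |(sin (t / 2) / sin (α / 2)) ^ 2 - cos ((2 * (n : ℝ) + 1) * π / (2 * m)) ^ 2| := by
      have h3 : cos t = 1 - 2 * sin (t / 2) ^ 2 := by
        have h4 := cos_two_mul (t / 2)
        have h5 := sin_sq_add_cos_sq (t / 2)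
        rw [mul_div_cancel₀ t two_ne_zero] at h4
        linarith
      rw [mrCoeff, h3, ← abs_two, ← abs_mul, abs_two, ← abs_of_pos (by positivity :
        0 < 4 * sin (α / 2) ^ 2), ← abs_mul, ← abs_neg]
      congr 1
      rw [show π * (2 * ((n + 1 : ℕ) : ℝ) - 1) = (2 * (n : ℝ) + 1) * π by push_cast; ring,
        div_pow]
      field_simp
      ring
    rw [h1, eval_mul, norm_mul, ih, norm_eval_quadratic, h2, Finset.prod_range_succ, abs_mul]
    ring

/-- With u = sin(t/2)/sin(α/2) one has cos t - a_k = -2 sin²(α/2)(u² - x_k²), where ±x_k are paired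
zeros of T_m. For odd m the factor |z - 1| = 2|sin(t/2)| supplies the zero u = 0. -/
theorem norm_eval_mrPolynomial {m : ℕ} (hm : m ≠ 0) {α : ℝ} (hs : 0 < sin (α / 2)) (t : ℝ) :
    ‖(mrPolynomial m α).eval (Complex.exp ((t : ℂ) * Complex.I))‖ =
      2 * sin (α / 2) ^ m * |(Chebyshev.T ℝ m).eval (sin (t / 2) / sin (α / 2))| := by
  have hm0 : (m : ℝ) ≠ 0 := by exact_mod_cast hm
  have hneg : ∀ k j : ℕ, k + j + 1 = m → cos ((2 * (j : ℝ) + 1) * π / (2 * m)) =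
      -cos ((2 * (k : ℝ) + 1) * π / (2 * m)) := fun k j hkj => by
    rw [← cos_pi_sub]
    congr 1
    have : (m : ℝ) = k + j + 1 := by rw [← hkj]; push_cast; ring
    field_simp
    rw [this]
    ring
  rw [eval_T_real_eq_prod, mrPolynomial]
  split_ifs with he
  · obtain ⟨n, rfl⟩ := even_iff_two_dvd.1 he
    rw [prod_range_two_mul_of_neg (fun k hk => hneg k _ (by omega)), Nat.mul_div_cancel_left _ two_pos,
      norm_eval_mrProduct n _ hs, abs_mul, abs_of_pos (by positivity : (0 : ℝ) < 2 ^ (2 * n - 1)),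
      mul_pow, ← pow_mul, show (4 : ℝ) = 2 ^ 2 by norm_num, ← pow_mul,
      show 2 ^ (2 * n) = (2 : ℝ) * 2 ^ (2 * n - 1) by
        rw [← pow_succ']; congr 1; omega]
    ring
  · obtain ⟨n, rfl⟩ := Nat.not_even_iff_odd.1 he
    rw [prod_range_two_mul_add_one_of_neg _ (fun k hk => hneg k _ (by omega)),
      show (2 * n + 1) / 2 = n by omega, eval_mul, norm_mul, eval_sub, eval_X, eval_one,
      norm_exp_sub_one, norm_eval_mrProduct n _ hs, abs_mul, abs_mul, abs_div, abs_of_pos hs,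
      abs_of_pos (by positivity : (0 : ℝ) < 2 ^ (2 * n + 1 - 1)), Nat.add_sub_cancel, pow_mul 2 2 n,
      pow_succ (sin (α / 2)) (2 * n), pow_mul (sin (α / 2)), mul_pow]
    · generalize |∏ k ∈ Finset.range n, (_ : ℝ)| = p
      norm_num
      field_simp
    · rw [cos_eq_zero_iff]
      refine ⟨0, ?_⟩
      push_cast at hm0 ⊢
      field_simp
      ring

theorem countable_sin_div_two_eq (c : ℝ) : {t : ℝ | sin (t / 2) = c}.Countable := by
  rcases {t : ℝ | sin (t / 2) = c}.eq_empty_or_nonempty with h | ⟨t, ht⟩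
  · rw [h]
    exact countable_empty
  refine ((countable_range fun k : ℤ => 2 * (2 * k * π + t / 2)).union
    (countable_range fun k : ℤ => 2 * ((2 * k + 1) * π - t / 2))).mono fun x hx => ?_
  obtain ⟨k, hk | hk⟩ := Real.sin_eq_sin_iff.1 ((show sin (t / 2) = c from ht).trans hx.symm)
  · exact Or.inl ⟨k, by simp only; linarith⟩
  · exact Or.inr ⟨k, by simp only; linarith⟩

/-- |T_m(u)| > 1 forces |u| > 1, that is t ∈ (α, 2π - α). The points with |T_m(u)| = 1 have u =
cos(kπ/m), which allows only countably many t. -/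
theorem superlevelMeasure_mrPolynomial_le {m : ℕ} (hm : m ≠ 0) {α : ℝ} (hα : α ∈ Ioo 0 π) :
    superlevelMeasure (mrPolynomial m α) (2 * sin (α / 2) ^ m) ≤ 2 * π - 2 * α := by
  have hs : 0 < sin (α / 2) :=
    sin_pos_of_pos_of_lt_pi (by linarith [hα.1]) (by linarith [hα.2, pi_pos])
  have hcount : (⋃ k : ℕ, {t : ℝ | sin (t / 2) = sin (α / 2) * cos (k * π / m)}).Countable :=
    countable_iUnion fun k => countable_sin_div_two_eq _
  have hsub : {t : ℝ | t ∈ Icc 0 (2 * π) ∧ 2 * sin (α / 2) ^ m ≤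
      ‖(mrPolynomial m α).eval (Complex.exp ((t : ℂ) * Complex.I))‖} ⊆
      Ioo α (2 * π - α) ∪
        ⋃ k : ℕ, {t : ℝ | sin (t / 2) = sin (α / 2) * cos (k * π / m)} := by
    rintro t ⟨ht, hle⟩
    rw [norm_eval_mrPolynomial hm hs, le_mul_iff_one_le_right (by positivity)] at hle
    rcases hle.eq_or_lt with h1 | h1
    · obtain ⟨k, -, hk⟩ := (Chebyshev.abs_eval_T_real_eq_one_iff hm _).1 h1.symm
      refine Or.inr (mem_iUnion.2 ⟨k, ?_⟩)
      rw [mem_ofPred_eq, ← hk]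
      field_simp
    · refine Or.inl ?_
      have h2 : 1 < |sin (t / 2) / sin (α / 2)| := by
        by_contra! h
        exact (Chebyshev.abs_eval_T_real_le_one m h).not_gt h1
      rw [abs_div, abs_of_pos hs, one_lt_div hs, abs_of_nonneg (sin_nonneg_of_nonneg_of_le_pi
        (by linarith [ht.1]) (by linarith [ht.2]))] at h2
      constructor
      · by_contra! h
        exact (sin_le_sin_of_le_of_le_pi_div_two (by linarith [ht.1, pi_pos])
          (by linarith [hα.2]) (by linarith : t / 2 ≤ α / 2)).not_gt h2
      · by_contra! h
        rw [← sin_pi_sub (t / 2)] at h2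
        exact (sin_le_sin_of_le_of_le_pi_div_two (by linarith [ht.2, pi_pos])
          (by linarith [hα.2]) (by linarith : π - t / 2 ≤ α / 2)).not_gt h2
  have h0 : volume (⋃ k : ℕ, {t : ℝ | sin (t / 2) = sin (α / 2) * cos (k * π / m)}) = 0 :=
    hcount.measure_zero _
  refine (measureReal_mono hsub ?_).trans ((measureReal_union_le _ _).trans ?_)
  · refine ((measure_union_le _ _).trans_lt ?_).ne
    rw [h0, add_zero]
    exact measure_Ioo_lt_top
  · rw [measureReal_def volume (⋃ k : ℕ, _), h0, Real.volume_real_Ioo_of_le (by linarith [hα.2])]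
    simp only [ENNReal.toReal_zero]
    linarith

/-! ### Rotations -/

theorem norm_eval_rotatePolynomial (m : ℕ) (θ : ℝ) (P : ℂ[X]) (t : ℝ) :
    ‖(rotatePolynomial m θ P).eval (Complex.exp ((t : ℂ) * Complex.I))‖ =
      ‖P.eval (Complex.exp (((t - θ : ℝ) : ℂ) * Complex.I))‖ := by
  rw [rotatePolynomial, eval_C_mul, eval_comp, eval_C_mul, eval_X, norm_mul, ← Complex.exp_add,
    show (m : ℂ) * θ * Complex.I = ((m * θ : ℝ) : ℂ) * Complex.I by push_cast; ring,
    Complex.norm_exp_ofReal_mul_I, one_mul]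
  congr 3
  push_cast
  ring

/-- In this form rotation invariance becomes invariance under shifts of the integral of a periodic
function over a period. -/
theorem superlevelMeasure_eq_integral (P : ℂ[X]) (h : ℝ) :
    superlevelMeasure P h = ∫ t in (0 : ℝ)..2 * π,
      indicator {t : ℝ | h ≤ ‖P.eval (Complex.exp ((t : ℂ) * Complex.I))‖} (1 : ℝ → ℝ) t := by
  have hS : MeasurableSet {t : ℝ | h ≤ ‖P.eval (Complex.exp ((t : ℂ) * Complex.I))‖} :=
    (isClosed_le continuous_const
      (P.continuous.comp (by fun_prop)).norm).measurableSet
  rw [intervalIntegral.integral_of_le (by positivity), ← integral_Icc_eq_integral_Ioc,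
    integral_indicator_one hS, measureReal_restrict_apply hS, superlevelMeasure, inter_comm]
  rfl

theorem superlevelMeasure_rotatePolynomial (m : ℕ) (θ : ℝ) (P : ℂ[X]) (h : ℝ) :
    superlevelMeasure (rotatePolynomial m θ P) h = superlevelMeasure P h := by
  rw [superlevelMeasure_eq_integral, superlevelMeasure_eq_integral]
  set g := indicator {t : ℝ | h ≤ ‖P.eval (Complex.exp ((t : ℂ) * Complex.I))‖} (1 : ℝ → ℝ)
    with hg
  have h1 : ∀ t : ℝ, indicator {t : ℝ | h ≤ ‖(rotatePolynomial m θ P).eval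
      (Complex.exp ((t : ℂ) * Complex.I))‖} (1 : ℝ → ℝ) t = g (t - θ) := fun t => by
    simp only [hg, indicator, mem_ofPred_eq, norm_eval_rotatePolynomial, Pi.one_apply]
  have hper : Function.Periodic g (2 * π) := fun t => by
    have h2 : Complex.exp (((t + 2 * π : ℝ) : ℂ) * Complex.I) =
        Complex.exp ((t : ℂ) * Complex.I) := by
      push_cast
      rw [add_mul, Complex.exp_add, Complex.exp_two_pi_mul_I, mul_one]
    simp only [hg, indicator, mem_ofPred_eq, h2, Pi.one_apply]
  simp only [h1]
  rw [intervalIntegral.integral_comp_sub_right]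
  have := hper.intervalIntegral_add_eq (0 - θ) 0
  rw [zero_add] at this
  rw [← this]
  congr 1
  ring

theorem rotatePolynomial_mem_circlePolynomials {m : ℕ} (θ : ℝ) {P : ℂ[X]}
    (hP : P ∈ circlePolynomials m) : rotatePolynomial m θ P ∈ circlePolynomials m := by
  obtain ⟨φ, rfl⟩ := hP
  refine ⟨fun j => φ j + θ, ?_⟩
  have h1 : Complex.exp ((m : ℂ) * θ * Complex.I) = ∏ _j : Fin m, Complex.exp (θ * Complex.I) := by
    rw [Finset.prod_const, Finset.card_univ, Fintype.card_fin, ← Complex.exp_nat_mul, mul_assoc]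
  rw [rotatePolynomial, h1, map_prod, prod_comp, ← Finset.prod_mul_distrib]
  refine Finset.prod_congr rfl fun j _ => ?_
  rw [sub_comp, X_comp, C_comp, mul_sub, ← mul_assoc, ← C_mul, ← C_mul, ← Complex.exp_add,
    ← Complex.exp_add]
  rw [show (θ : ℂ) * Complex.I + -θ * Complex.I = 0 by ring, Complex.exp_zero, C_1, one_mul]
  congr 3
  push_cast
  ring

/-! ### The value of the infimum and the parameter α -/

theorem two_pi_sub_superlevelMeasure_le (P : ℂ[X]) (h : ℝ) :
    2 * π - superlevelMeasure P h ≤ volume.real {t : ℝ | t ∈ Icc 0 (2 * π) ∧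
      ‖P.eval (Complex.exp ((t : ℂ) * Complex.I))‖ ≤ h} := by
  have hsub : Icc 0 (2 * π) ⊆
      {t : ℝ | t ∈ Icc 0 (2 * π) ∧ h ≤ ‖P.eval (Complex.exp ((t : ℂ) * Complex.I))‖} ∪
      {t : ℝ | t ∈ Icc 0 (2 * π) ∧ ‖P.eval (Complex.exp ((t : ℂ) * Complex.I))‖ ≤ h} :=
    fun t ht => (le_total h _).imp (fun h => ⟨ht, h⟩) fun h => ⟨ht, h⟩
  have h1 := (measureReal_mono (μ := volume) hsub ((isCompact_Icc (a := 0) (b := 2 * π)).measure_lt_top.trans_le'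
    (measure_mono (union_subset (fun t ht => ht.1) fun t ht => ht.1))).ne).trans
    (measureReal_union_le _ _)
  rw [Real.volume_real_Icc_of_le (by positivity), sub_zero] at h1
  rw [superlevelMeasure]
  linarith

theorem le_superlevelMeasure {m : ℕ} (hm : m ≠ 0) {α : ℝ} (hα : α ∈ Ioo 0 π) {P : ℂ[X]}
    (hP : P ∈ circlePolynomials m) :
    2 * π - 2 * α ≤ superlevelMeasure P (2 * sin (α / 2) ^ m) := by
  linarith [measureReal_sublevel_le hm hα hP,
    two_pi_sub_superlevelMeasure_le P (2 * sin (α / 2) ^ m)]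

theorem superlevelMeasure_mrPolynomial {m : ℕ} (hm : m ≠ 0) {α : ℝ} (hα : α ∈ Ioo 0 π) :
    superlevelMeasure (mrPolynomial m α) (2 * sin (α / 2) ^ m) = 2 * π - 2 * α :=
  (superlevelMeasure_mrPolynomial_le hm hα).antisymm
    (le_superlevelMeasure hm hα (mrPolynomial_mem_circlePolynomials m α))

theorem delta_eq {m : ℕ} (hm : m ≠ 0) {α : ℝ} (hα : α ∈ Ioo 0 π) :
    delta m (2 * sin (α / 2) ^ m) = 2 * π - 2 * α := by
  refine IsLeast.csInf_eq ⟨⟨_, mrPolynomial_mem_circlePolynomials m α,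
    superlevelMeasure_mrPolynomial hm hα⟩, ?_⟩
  rintro _ ⟨P, hP, rfl⟩
  exact le_superlevelMeasure hm hα hP

theorem isExtremal_rotatePolynomial {m : ℕ} (hm : m ≠ 0) {α : ℝ} (hα : α ∈ Ioo 0 π) (θ : ℝ) :
    IsExtremal m (2 * sin (α / 2) ^ m) (rotatePolynomial m θ (mrPolynomial m α)) :=
  ⟨rotatePolynomial_mem_circlePolynomials θ (mrPolynomial_mem_circlePolynomials m α), by
    rw [superlevelMeasure_rotatePolynomial, superlevelMeasure_mrPolynomial hm hα, delta_eq hm hα]⟩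

theorem measureReal_sublevel_of_isExtremal {m : ℕ} (hm : m ≠ 0) {α : ℝ} (hα : α ∈ Ioo 0 π)
    {P : ℂ[X]} (hP : IsExtremal m (2 * sin (α / 2) ^ m) P) :
    volume.real {t : ℝ | t ∈ Icc 0 (2 * π) ∧
      ‖P.eval (Complex.exp ((t : ℂ) * Complex.I))‖ ≤ 2 * sin (α / 2) ^ m} = 2 * α := by
  have h := two_pi_sub_superlevelMeasure_le P (2 * sin (α / 2) ^ m)
  rw [hP.2, delta_eq hm hα] at h
  exact (measureReal_sublevel_le hm hα hP.1).antisymm (by linarith)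

theorem rpow_inv_eq_sin {m : ℕ} (hm : m ≠ 0) {α : ℝ} (hα : α ∈ Ioo 0 π) :
    (2 * sin (α / 2) ^ m / 2) ^ (1 / (m : ℝ)) = sin (α / 2) := by
  have hs : 0 < sin (α / 2) :=
    sin_pos_of_pos_of_lt_pi (by linarith [hα.1]) (by linarith [hα.2, pi_pos])
  rw [mul_div_cancel_left₀ _ two_ne_zero, one_div, Real.pow_rpow_inv_natCast hs.le hm]

theorem four_mul_arccos_eq {m : ℕ} (hm : m ≠ 0) {α : ℝ} (hα : α ∈ Ioo 0 π) :
    4 * arccos ((2 * sin (α / 2) ^ m / 2) ^ (1 / (m : ℝ))) = 2 * π - 2 * α := by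
  rw [rpow_inv_eq_sin hm hα, arccos_eq_pi_div_two_sub_arcsin, arcsin_sin]
  · ring
  · linarith [hα.1, pi_pos]
  · linarith [hα.2]

theorem existsUnique_eq_two_mul_sin_pow {m : ℕ} (hm : m ≠ 0) {h : ℝ} (h_pos : 0 < h)
    (h_lt : h < 2) : ∃! α : ℝ, α ∈ Ioo 0 π ∧ h = 2 * sin (α / 2) ^ m := by
  set s := (h / 2) ^ (1 / (m : ℝ)) with hs
  have hs0 : 0 < s := rpow_pos_of_pos (by linarith) _
  have hs1 : s < 1 := rpow_lt_one (by linarith) (by linarith) (by positivity)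
  refine ⟨2 * arcsin s, ⟨⟨by linarith [arcsin_pos.2 hs0], by
    linarith [arcsin_lt_pi_div_two.2 hs1]⟩, ?_⟩, ?_⟩
  · rw [mul_div_cancel_left₀ _ two_ne_zero, sin_arcsin (by linarith) hs1.le, hs, one_div,
      Real.rpow_inv_natCast_pow (by linarith) hm]
    ring
  · rintro β ⟨hβ, rfl⟩
    rw [hs, rpow_inv_eq_sin hm hβ, arcsin_sin]
    · ring
    · linarith [hβ.1, pi_pos]
    · linarith [hβ.2]

/-! ### Uniqueness of the extremal polynomials -/

theorem isPreconnected_setOf_one_lt_norm : IsPreconnected {z : ℂ | 1 < ‖z‖} := by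
  have h : {z : ℂ | 1 < ‖z‖} = Complex.exp '' {z : ℂ | 0 < z.re} := by
    ext z
    constructor
    · intro (hz : 1 < ‖z‖)
      have hz0 : z ≠ 0 := norm_pos_iff.1 (by linarith)
      exact ⟨Complex.log z, by simpa [Complex.log_re] using log_pos hz, Complex.exp_log hz0⟩
    · rintro ⟨w, hw, rfl⟩
      simpa [Complex.norm_exp] using hw
  rw [h]
  exact (convex_halfSpace_re_gt 0).isPreconnected.image _ Complex.continuous_exp.continuousOn

/-- The point w joins the open disc to the exterior, and the rest of the complement lies in the
closure of their union. -/
theorem isPreconnected_compl_circleImage {K : Set ℝ} {w : ℂ} (hw1 : ‖w‖ = 1)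
    (hw : w ∉ circleImage K) : IsPreconnected (circleImage K)ᶜ := by
  have hin : ∀ z : ℂ, ‖z‖ ≤ 1 → z ∈ closure (Metric.ball (0 : ℂ) 1) := fun z hz => by
    rw [closure_ball _ one_ne_zero]
    simpa using hz
  have hout : w ∈ closure {z : ℂ | 1 < ‖z‖} := by
    rw [Metric.mem_closure_iff]
    intro ε hε
    refine ⟨((1 + ε / 2 : ℝ) : ℂ) * w, ?_, ?_⟩
    · simp only [mem_ofPred_eq, norm_mul, hw1, Complex.norm_real, norm_eq_abs]
      rw [abs_of_pos (by positivity)]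
      linarith
    · rw [dist_eq_norm, show w - ((1 + ε / 2 : ℝ) : ℂ) * w = -((ε / 2 : ℝ) : ℂ) * w by
        push_cast; ring, norm_mul, hw1, norm_neg, Complex.norm_real, norm_eq_abs,
        abs_of_pos (by positivity)]
      linarith
  have h1 : IsPreconnected (insert w (Metric.ball (0 : ℂ) 1)) :=
    (convex_ball 0 1).isPreconnected.subset_closure (subset_insert _ _)
      (insert_subset (hin w hw1.le) subset_closure)
  have h2 : IsPreconnected (insert w {z : ℂ | 1 < ‖z‖}) :=
    isPreconnected_setOf_one_lt_norm.subset_closure (subset_insert _ _)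
      (insert_subset hout subset_closure)
  have h3 := h1.union w (mem_insert _ _) (mem_insert _ _) h2
  refine h3.subset_closure ?_ ?_
  · rintro z ((rfl | hz) | (rfl | hz))
    · exact hw
    · exact notMem_circleImage_of_norm_ne_one (by simpa using hz : ‖z‖ < 1).ne
    · exact hw
    · exact notMem_circleImage_of_norm_ne_one (ne_of_gt hz)
  · intro z _
    rcases le_or_gt ‖z‖ 1 with hz | hz
    · exact closure_mono (subset_union_of_subset_left (subset_insert _ _) _) (hin z hz)
    · exact subset_closure (Or.inr (Or.inr hz))

/-- In the extremal case the quadratic relation between the polynomial and the map into the disc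
holds on the whole complement of the level set. -/
theorem exists_quadratic_relation {m : ℕ} (hm : m ≠ 0) {h : ℝ} (h_pos : 0 < h) {P : ℂ[X]}
    (hP : P ∈ circlePolynomials m) {K : Set ℝ} (hK : IsCompact K) (hsub : K ⊆ Icc 0 (2 * π))
    (hlt : volume.real K < 2 * π) (hle : ∀ z ∈ circleImage K, ‖P.eval z‖ ≤ h)
    (heq : 2 / h * sin (volume.real K / 4) ^ m = 1) {w : ℂ} (hw1 : ‖w‖ = 1)
    (hw : w ∉ circleImage K) {γ : ℂ} (hγ : γ = 2 / h * P.eval 0 * discMap K 0 ^ m) :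
    ‖γ‖ = 1 ∧ ∀ z ∉ circleImage K, 2 / h * P.eval z * discMap K z ^ m =
      γ + P.eval 0 / γ * z ^ m * discMap K z ^ (2 * m) := by
  set ε := P.eval 0 with hε
  have hε1 : ‖ε‖ = 1 := norm_eval_zero_of_mem_circlePolynomials hP
  have hε0 : ε ≠ 0 := norm_pos_iff.1 (by rw [hε1]; exact one_pos)
  have h0 : (h : ℂ) ≠ 0 := by exact_mod_cast h_pos.ne'
  have hγ1 : ‖γ‖ = 1 := by
    rw [hγ, norm_mul, norm_mul, norm_pow, norm_discMap_zero hlt, hε1, mul_one, norm_div,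
      Complex.norm_real, norm_eq_abs, abs_of_pos h_pos, Complex.norm_ofNat, heq]
  have hγ0 : γ ≠ 0 := norm_pos_iff.1 (by rw [hγ1]; exact one_pos)
  refine ⟨hγ1, ?_⟩
  -- The discriminant of the quadratic for x and y, up to a constant normalised so that D(0) = 1;
  -- the principal square root is then holomorphic near 0 and separates the two roots.
  set D : ℂ → ℂ := fun z => (P.eval z ^ 2 - h ^ 2 * ε * z ^ m) / ε ^ 2 with hD
  have hD0 : D 0 = 1 := by
    simp only [hD, zero_pow hm, mul_zero, sub_zero, ← hε]
    exact div_self (pow_ne_zero 2 hε0)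
  have hDd : Differentiable ℂ D := by
    have := P.differentiable
    simp only [hD]
    fun_prop
  set r : ℂ → ℂ := fun z => Complex.exp (Complex.log (D z) / 2) with hr
  have hr0 : r 0 = 1 := by simp [hr, hD0]
  have hslit : ∀ᶠ z in nhds 0, D z ∈ Complex.slitPlane :=
    hDd.continuous.continuousAt.eventually_mem
      (Complex.isOpen_slitPlane.mem_nhds (by rw [hD0]; exact Complex.one_mem_slitPlane))
  have hrd : ∀ᶠ z in nhds 0, DifferentiableAt ℂ r z := hslit.mono fun z hz =>
    (((hDd z).clog hz).div_const 2).cexp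
  have hr2 : ∀ᶠ z in nhds 0, r z ^ 2 = D z := hslit.mono fun z hz => by
    rw [hr, ← Complex.exp_nat_mul, Nat.cast_ofNat, mul_div_cancel₀ _ two_ne_zero,
      Complex.exp_log (Complex.slitPlane_ne_zero hz)]
  set x : ℂ → ℂ := fun z => (P.eval z + ε * r z) / h with hx
  set y : ℂ → ℂ := fun z => (P.eval z - ε * r z) / h with hy
  have hadd : ∀ z, x z + y z = 2 / h * P.eval z := fun z => by
    simp only [hx, hy]
    ring
  have hmul : ∀ᶠ z in nhds 0, x z * y z = ε * z ^ m := hr2.mono fun z hz => by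
    have : x z * y z = (P.eval z ^ 2 - ε ^ 2 * r z ^ 2) / h ^ 2 := by
      simp only [hx, hy]
      ring
    rw [this, hz]
    simp only [hD]
    field_simp
    ring
  have hxd : ∀ᶠ z in nhds 0, DifferentiableAt ℂ x z := hrd.mono fun z hz =>
    ((P.differentiableAt).add (hz.const_mul _)).div_const _
  have hyd : DifferentiableAt ℂ y 0 :=
    ((P.differentiableAt).sub (hrd.self_of_nhds.const_mul _)).div_const _
  have hx0 : x 0 = 2 / h * ε := by
    simp only [hx, hr0, ← hε]
    ring
  have hy0 : y 0 = 0 := by simp [hy, hr0, ← hε]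
  have hxy : ∀ᶠ z in nhds 0, ‖y z‖ < ‖x z‖ := by
    refine hyd.continuousAt.norm.eventually_lt hxd.self_of_nhds.continuousAt.norm ?_
    rw [hx0, hy0, norm_zero, norm_pos_iff]
    exact mul_ne_zero (div_ne_zero two_ne_zero h0) hε0
  have hmem : ∀ᶠ z in nhds 0, z ∉ circleImage K :=
    (isOpen_compl_circleImage hK).mem_nhds (zero_notMem_circleImage K)
  -- The modulus is at most 1 near 0 and equals 1 at 0.
  have hconst : ∀ᶠ z in nhds 0, x z * discMap K z ^ m = γ := by
    have hd : ∀ᶠ z in nhds 0, DifferentiableAt ℂ (fun z => x z * discMap K z ^ m) z := by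
      filter_upwards [hxd, hmem] with z hz hz'
      exact hz.mul ((differentiableAt_discMap hK hsub hlt hz').pow _)
    have hF0 : x 0 * discMap K 0 ^ m = γ := by rw [hx0, hγ]
    have hmax : IsLocalMax (norm ∘ fun z => x z * discMap K z ^ m) 0 := by
      filter_upwards [hmul, hxy, hmem] with z h1 h2 h3
      simp only [Function.comp_apply]
      rw [hF0, hγ1, norm_mul, norm_pow]
      exact norm_mul_norm_discMap_pow_le_one hm h_pos hP hK hsub hlt hle h3 (hadd z) h1 h2
    filter_upwards [Complex.eventually_eq_of_isLocalMax_norm hd hmax] with z hz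
    rw [hz, hF0]
  have hopen := isOpen_compl_circleImage hK
  have hbd : DifferentiableOn ℂ (discMap K) (circleImage K)ᶜ := fun z hz =>
    (differentiableAt_discMap hK hsub hlt hz).differentiableWithinAt
  have hPd : DifferentiableOn ℂ (fun z => P.eval z) (circleImage K)ᶜ :=
    P.differentiable.differentiableOn
  have h1 : AnalyticOnNhd ℂ (fun z => 2 / h * P.eval z * discMap K z ^ m) (circleImage K)ᶜ :=
    DifferentiableOn.analyticOnNhd (by fun_prop) hopen
  have h2 : AnalyticOnNhd ℂ (fun z => γ + ε / γ * z ^ m * discMap K z ^ (2 * m))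
      (circleImage K)ᶜ :=
    DifferentiableOn.analyticOnNhd (by fun_prop) hopen
  -- Near 0 the relation is x + y = 2P/h multiplied by B^m, with xB^m = γ and xy = P(0)z^m. Unlike x
  -- and y, both its sides are single-valued off K, so the identity theorem applies.
  have h3 := h1.eqOn_of_preconnected_of_eventuallyEq h2 (isPreconnected_compl_circleImage hw1 hw)
    (zero_notMem_circleImage K) (by
      filter_upwards [hconst, hmul] with z hz hz'
      have h4 : y z * discMap K z ^ m * γ = ε * z ^ m * discMap K z ^ (2 * m) := by
        rw [← hz', ← hz]
        ring
      rw [← hadd, add_mul, hz]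
      congr 1
      field_simp
      linear_combination h4)
  exact fun z hz => h3 hz

/-- The quotient g(z)/z, extended over 0 by `dslope`, has constant modulus 1 and so is constant by
the maximum principle. -/
theorem eventually_eq_mul_of_norm_eq {g : ℂ → ℂ} (hg : ∀ᶠ z in nhds 0, DifferentiableAt ℂ g z)
    (hnorm : ∀ᶠ z in nhds 0, ‖g z‖ = ‖z‖) :
    ∃ c : ℂ, ‖c‖ = 1 ∧ ∀ᶠ z in nhds 0, g z = c * z := by
  have hg0 : g 0 = 0 := norm_eq_zero.1 (by rw [hnorm.self_of_nhds, norm_zero])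
  obtain ⟨s, hs, hso, h0s⟩ := eventually_nhds_iff.1 hg
  have hq : DifferentiableOn ℂ (dslope g 0) s :=
    (Complex.differentiableOn_dslope (hso.mem_nhds h0s)).2 fun z hz =>
      (hs z hz).differentiableWithinAt
  have hqd : ∀ᶠ z in nhds 0, DifferentiableAt ℂ (dslope g 0) z := by
    filter_upwards [hso.mem_nhds h0s] with z hz
    exact hq.differentiableAt (hso.mem_nhds hz)
  have hne : ∀ᶠ z in nhdsWithin 0 {(0 : ℂ)}ᶜ, ‖dslope g 0 z‖ = 1 := by
    filter_upwards [hnorm.filter_mono nhdsWithin_le_nhds, self_mem_nhdsWithin] with z hz hz0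
    rw [dslope_of_ne _ hz0, slope_def_field, hg0, sub_zero, sub_zero, norm_div, hz]
    exact div_self (norm_ne_zero_iff.2 hz0)
  have h0 : ‖dslope g 0 0‖ = 1 := by
    have h1 : Filter.Tendsto (fun z => ‖dslope g 0 z‖) (nhdsWithin 0 {(0 : ℂ)}ᶜ)
        (nhds ‖dslope g 0 0‖) :=
      hqd.self_of_nhds.continuousAt.norm.tendsto.mono_left nhdsWithin_le_nhds
    exact tendsto_nhds_unique h1 (tendsto_const_nhds.congr' (hne.mono fun z hz => hz.symm))
  have hmax : IsLocalMax (norm ∘ dslope g 0) 0 := by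
    filter_upwards [eventually_nhdsWithin_iff.1 hne] with z hz
    simp only [Function.comp_apply, h0]
    by_cases h : z = 0
    · rw [h, h0]
    · exact (hz h).le
  refine ⟨dslope g 0 0, h0, ?_⟩
  filter_upwards [Complex.eventually_eq_of_isLocalMax_norm hqd hmax] with z hz
  have := sub_smul_dslope g 0 z
  rw [hg0, sub_zero, sub_zero, hz, smul_eq_mul] at this
  rw [← this, mul_comm]

/-- Reflecting the relation in the circle gives a second one, between P and the reflected map B*,
because P is self-reciprocal. Eliminating P yields γB*^m = (P(0)/γ)z^m B^m near 0, hence |B*/B| =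
|z|. -/
theorem exists_discMapReflected_eq {m : ℕ} (hm : m ≠ 0) {h : ℝ} (h_pos : 0 < h) {P : ℂ[X]}
    (hP : P ∈ circlePolynomials m) {K : Set ℝ} (hK : IsCompact K) (hsub : K ⊆ Icc 0 (2 * π))
    (hlt : volume.real K < 2 * π) (hb0 : discMap K 0 ≠ 0) {γ : ℂ} (hγ1 : ‖γ‖ = 1)
    (hrel : ∀ z ∉ circleImage K, 2 / h * P.eval z * discMap K z ^ m =
      γ + P.eval 0 / γ * z ^ m * discMap K z ^ (2 * m)) :
    ∃ c : ℂ, ‖c‖ = 1 ∧ γ ^ 2 * c ^ m = P.eval 0 ∧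
      ∀ᶠ z in nhds 0, discMapReflected K z = c * z * discMap K z := by
  set ε := P.eval 0 with hε
  have hε1 : ‖ε‖ = 1 := norm_eval_zero_of_mem_circlePolynomials hP
  have hε0 : ε ≠ 0 := norm_pos_iff.1 (by rw [hε1]; exact one_pos)
  have hγ0 : γ ≠ 0 := norm_pos_iff.1 (by rw [hγ1]; exact one_pos)
  have h0 : (h : ℂ) ≠ 0 := by exact_mod_cast h_pos.ne'
  have hmem : ∀ᶠ z in nhds 0, z ∉ circleImage K :=
    (isOpen_compl_circleImage hK).mem_nhds (zero_notMem_circleImage K)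
  have hbd : ∀ᶠ z in nhds 0, DifferentiableAt ℂ (discMap K) z :=
    hmem.mono fun z hz => differentiableAt_discMap hK hsub hlt hz
  have hbd' : ∀ᶠ z in nhds 0, DifferentiableAt ℂ (discMapReflected K) z :=
    hmem.mono fun z hz => differentiableAt_discMapReflected hK hsub hlt hz
  have hbne : ∀ᶠ z in nhds 0, discMap K z ≠ 0 :=
    hbd.self_of_nhds.continuousAt.eventually_ne hb0
  have hprod : ∀ᶠ z in nhds 0, 1 - discMap K z ^ m * discMapReflected K z ^ m ≠ 0 := by
    refine ContinuousAt.eventually_ne (continuousAt_const.sub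
      ((hbd.self_of_nhds.continuousAt.pow m).mul (hbd'.self_of_nhds.continuousAt.pow m))) ?_
    rw [discMapReflected_zero, zero_pow hm, mul_zero, sub_zero]
    exact one_ne_zero
  have hball : ∀ᶠ z : ℂ in nhds 0, ‖z‖ < 1 :=
    continuous_norm.continuousAt.eventually_lt_const (by simp)
  have hkey : ∀ᶠ z in nhds 0, γ * discMapReflected K z ^ m = ε / γ * z ^ m * discMap K z ^ m := by
    filter_upwards [hmem, hprod, hball] with z hz hz1 hz2
    rcases eq_or_ne z 0 with rfl | hz0
    · rw [discMapReflected_zero, zero_pow hm]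
      ring
    have hw : ((starRingEnd ℂ) z)⁻¹ ∉ circleImage K := by
      refine notMem_circleImage_of_norm_ne_one ?_
      rw [norm_inv, RCLike.norm_conj]
      exact (one_lt_inv_iff₀.2 ⟨norm_pos_iff.2 hz0, hz2⟩).ne'
    have h1 := congrArg (starRingEnd ℂ) (hrel _ hw)
    rw [discMap_reflect K hz0] at h1
    simp only [map_mul, map_add, map_div₀, map_pow, map_inv₀, Complex.conj_conj,
      Complex.conj_ofReal, map_ofNat] at h1
    rw [← Complex.inv_eq_conj hγ1, ← Complex.inv_eq_conj hε1] at h1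
    have h2 := eval_eq_reflect_of_mem_circlePolynomials hP hz0
    rw [← hε] at h2
    have h3 : 2 / h * P.eval z * discMapReflected K z ^ m =
        ε / γ * z ^ m + γ * discMapReflected K z ^ (2 * m) := by
      rw [h2]
      calc _ = ε * z ^ m * (2 / h * (starRingEnd ℂ) (P.eval ((starRingEnd ℂ) z)⁻¹) *
            discMapReflected K z ^ m) := by ring
        _ = _ := by
          rw [h1, inv_pow]
          field_simp
    have h4 := hrel z hz
    -- Elimination of P; the first factor is nonzero near 0 because B*(0) = 0.
    have h5 : (1 - discMap K z ^ m * discMapReflected K z ^ m) *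
        (γ * discMapReflected K z ^ m - ε / γ * z ^ m * discMap K z ^ m) = 0 := by
      rw [mul_comm 2 m, pow_mul] at h3 h4
      linear_combination discMap K z ^ m * h3 - discMapReflected K z ^ m * h4
    exact sub_eq_zero.1 ((mul_eq_zero.1 h5).resolve_left hz1)
  obtain ⟨c, hc1, hc⟩ := eventually_eq_mul_of_norm_eq
    (g := fun z => discMapReflected K z / discMap K z)
    (by filter_upwards [hbd, hbd', hbne] with z h1 h2 h3 using h2.div h1 h3)
    (by
      filter_upwards [hkey, hbne] with z h1 h2
      have h3 := congrArg norm h1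
      rw [norm_mul, norm_mul, norm_mul, norm_div, hγ1, hε1, div_one, one_mul, one_mul, norm_pow,
        norm_pow, norm_pow, ← mul_pow] at h3
      have h4 := (pow_left_inj₀ (norm_nonneg _) (by positivity) hm).1 h3
      rw [norm_div, h4, mul_div_cancel_right₀ _ (norm_ne_zero_iff.2 h2)])
  have hc' : ∀ᶠ z in nhds 0, discMapReflected K z = c * z * discMap K z := by
    filter_upwards [hc, hbne] with z h1 h2
    exact (div_eq_iff h2).1 h1
  refine ⟨c, hc1, ?_, hc'⟩
  have hne : ∀ᶠ z : ℂ in nhdsWithin 0 {0}ᶜ, z ≠ 0 := self_mem_nhdsWithin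
  obtain ⟨z, ⟨h1, h2, h3⟩, hz0⟩ :=
    (((hkey.and (hc'.and hbne)).filter_mono nhdsWithin_le_nhds).and hne).exists
  rw [h2, mul_pow, mul_pow] at h1
  field_simp at h1
  exact h1

/-- Near the origin an extremal polynomial is determined by a unimodular number. -/
theorem exists_local_representation {m : ℕ} (hm : m ≠ 0) {α : ℝ} (hα : α ∈ Ioo 0 π)
    {P : ℂ[X]} (hP : IsExtremal m (2 * sin (α / 2) ^ m) P) {q : ℂ}
    (hq : q = Complex.exp (((α / 2 : ℝ) : ℂ) * Complex.I)) :
    ∃ (c : ℂ) (p : ℂ → ℂ), ‖c‖ = 1 ∧ ContinuousAt p 0 ∧ p 0 = q ∧ ∀ᶠ z in nhds 0,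
      p z ^ 2 - q ^ 2 = c * z * (p z ^ 2 - q⁻¹ ^ 2) ∧
      P.eval z * ((p z - q⁻¹) / (p z + q)) ^ m * c ^ m *
        (((q - q⁻¹) / (q + q)) ^ m / sin (α / 2) ^ (2 * m)) =
      1 + (c * z) ^ m * ((p z - q⁻¹) / (p z + q)) ^ (2 * m) := by
  have hs : 0 < sin (α / 2) :=
    sin_pos_of_pos_of_lt_pi (by linarith [hα.1]) (by linarith [hα.2, pi_pos])
  set h := 2 * sin (α / 2) ^ m with hh
  have h_pos : 0 < h := by positivity
  set K := {t : ℝ | t ∈ Icc 0 (2 * π) ∧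
    ‖P.eval (Complex.exp ((t : ℂ) * Complex.I))‖ ≤ h} with hKdef
  have hK : IsCompact K := isCompact_sublevel P h _
  have hsub : K ⊆ Icc 0 (2 * π) := fun t ht => ht.1
  have hvol : volume.real K = 2 * α := measureReal_sublevel_of_isExtremal hm hα hP
  have hlt : volume.real K < 2 * π := by linarith [hα.2]
  have hle : ∀ z ∈ circleImage K, ‖P.eval z‖ ≤ h := by
    rintro z ⟨t, ht, rfl⟩
    exact ht.2
  have hquarter : volume.real K / 4 = α / 2 := by linarith
  have hqK : quarterPhase K = q := by rw [quarterPhase, hquarter, hq]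
  obtain ⟨w, hw1, hw⟩ : ∃ w : ℂ, ‖w‖ = 1 ∧ w ∉ circleImage K := by
    obtain ⟨t, ht, htK⟩ : ∃ t ∈ Icc 0 (2 * π), t ∉ K := by
      by_contra! hcon
      rw [hsub.antisymm hcon, Real.volume_real_Icc_of_le (by positivity), sub_zero] at hlt
      exact lt_irrefl _ hlt
    refine ⟨Complex.exp ((t : ℂ) * Complex.I), Complex.norm_exp_ofReal_mul_I t, fun hmem => ?_⟩
    exact htK ⟨ht, hle _ hmem⟩
  have heq : 2 / h * sin (volume.real K / 4) ^ m = 1 := by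
    rw [hquarter, hh]
    field_simp
  obtain ⟨hγ1, hrel⟩ := exists_quadratic_relation hm h_pos hP.1 hK hsub hlt hle heq hw1 hw rfl
  have hbnorm : ‖discMap K 0‖ = sin (α / 2) := by rw [norm_discMap_zero hlt, hquarter]
  have hb0 : discMap K 0 ≠ 0 := norm_pos_iff.1 (by rwa [hbnorm])
  obtain ⟨c, hc1, hc2, hc⟩ := exists_discMapReflected_eq hm h_pos hP.1 hK hsub hlt hb0 hγ1 hrel
  have hmem : ∀ᶠ z in nhds 0, z ∉ circleImage K :=
    (isOpen_compl_circleImage hK).mem_nhds (zero_notMem_circleImage K)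
  refine ⟨c, halfPlaneMap K, hc1,
    (differentiableAt_halfPlaneMap hK (zero_notMem_circleImage K)).continuousAt,
    by rw [halfPlaneMap_zero, hqK], ?_⟩
  have hε0 : P.eval 0 ≠ 0 :=
    norm_pos_iff.1 (by rw [norm_eval_zero_of_mem_circlePolynomials hP.1]; exact one_pos)
  filter_upwards [hmem, hc] with z hz hcz
  have hd1 := halfPlaneMap_add_ne_zero hK hsub hlt hz
  have hd2 := halfPlaneMap_add_inv_ne_zero hK hsub hlt hz
  have hrz := hrel z hz
  have hbz : discMap K z = (halfPlaneMap K z - q⁻¹) / (halfPlaneMap K z + q) := by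
    rw [discMap, hqK]
  have hb00 : discMap K 0 = (q - q⁻¹) / (q + q) := by
    rw [discMap, halfPlaneMap_zero, hqK]
  constructor
  -- Clearing denominators in B* = czB, where each side becomes a difference of squares.
  · rw [discMap, discMapReflected, hqK] at hcz
    rw [hqK] at hd1 hd2
    rw [mul_div_assoc', div_eq_div_iff hd2 hd1] at hcz
    linear_combination hcz
  · rw [← hbz, ← hb00]
    set ε := P.eval 0
    set β := discMap K 0 ^ m with hβ
    have hβ0 : β ≠ 0 := pow_ne_zero _ hb0
    have hs0 : (h : ℂ) ≠ 0 := by exact_mod_cast h_pos.ne'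
    have hs2 : ((sin (α / 2) : ℝ) : ℂ) ^ (2 * m) = (h / 2) ^ 2 := by
      rw [hh]
      push_cast
      ring
    set s : ℂ := ((sin (α / 2) : ℝ) : ℂ) ^ (2 * m) with hsdef
    -- This is γ²c^m = P(0) with γ = (2/h)P(0)β. It makes (2/h)βc^m the inverse of γ, and
    -- multiplying the relation by it removes P(0), leaving only c and α.
    have hγc : 4 / h ^ 2 * ε * β ^ 2 * c ^ m = 1 := by
      have h1 : ε * (4 / h ^ 2 * ε * β ^ 2 * c ^ m) = ε * 1 := by
        rw [mul_one]
        nth_rewrite 3 [← hc2]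
        ring
      exact mul_left_cancel₀ hε0 h1
    rw [hs2, mul_pow]
    have h1 : 2 / (h : ℂ) * ε * β ≠ 0 := by
      refine mul_ne_zero (mul_ne_zero (div_ne_zero two_ne_zero hs0) hε0) hβ0
    have h2 : (2 / (h : ℂ) * β * c ^ m) * (2 / h * ε * β) = 1 := by
      rw [← hγc]
      ring
    have h3 : ε / (2 / (h : ℂ) * ε * β) * (2 / (h : ℂ) * β) = 1 := by
      field_simp
    calc _ = (2 / (h : ℂ) * β * c ^ m) * (2 / h * P.eval z * discMap K z ^ m) := by
          field_simp
      _ = (2 / (h : ℂ) * β * c ^ m) * (2 / h * ε * β) +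
          ε / (2 / (h : ℂ) * ε * β) * (2 / (h : ℂ) * β) *
            (c ^ m * z ^ m * discMap K z ^ (2 * m)) := by
          rw [hrz]
          ring
      _ = _ := by rw [h2, h3, one_mul]

/-- If c and d are the numbers attached to P and Q, the substitution z ↦ (c/d)z in the equations for
Q turns d into c. The half plane maps then agree near 0, and so do the polynomials up to the factor
(d/c)^m. -/
theorem eq_rotatePolynomial_of_isExtremal {m : ℕ} (hm : m ≠ 0) {α : ℝ} (hα : α ∈ Ioo 0 π)
    {P Q : ℂ[X]} (hP : IsExtremal m (2 * sin (α / 2) ^ m) P)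
    (hQ : IsExtremal m (2 * sin (α / 2) ^ m) Q) : ∃ θ : ℝ, P = rotatePolynomial m θ Q := by
  have hs : 0 < sin (α / 2) :=
    sin_pos_of_pos_of_lt_pi (by linarith [hα.1]) (by linarith [hα.2, pi_pos])
  obtain ⟨q, hq⟩ : ∃ q : ℂ, q = Complex.exp (((α / 2 : ℝ) : ℂ) * Complex.I) := ⟨_, rfl⟩
  have hq0 : q ≠ 0 := by rw [hq]; exact Complex.exp_ne_zero _
  have hqs : q - q⁻¹ ≠ 0 := by
    intro h
    have h1 : (q - q⁻¹).im = 2 * sin (α / 2) := by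
      rw [hq, ← Complex.exp_neg, ← neg_mul, ← Complex.ofReal_neg, Complex.sub_im,
        Complex.exp_ofReal_mul_I_im, Complex.exp_ofReal_mul_I_im, sin_neg]
      ring
    rw [h, Complex.zero_im] at h1
    linarith
  have hqq : q + q ≠ 0 := by
    rw [← two_mul]
    exact mul_ne_zero two_ne_zero hq0
  obtain ⟨c, p, hc1, hpc, hp0, hp⟩ := exists_local_representation hm hα hP hq
  obtain ⟨d, r, hd1, hrc, hr0, hr⟩ := exists_local_representation hm hα hQ hq
  have hc0 : c ≠ 0 := norm_pos_iff.1 (by rw [hc1]; exact one_pos)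
  have hd0 : d ≠ 0 := norm_pos_iff.1 (by rw [hd1]; exact one_pos)
  have hlam : ‖c / d‖ = 1 := by rw [norm_div, hc1, hd1, div_one]
  have ht : Filter.Tendsto (fun z : ℂ => c / d * z) (nhds 0) (nhds 0) := by
    have : ContinuousAt (fun z : ℂ => c / d * z) 0 := by fun_prop
    simpa [ContinuousAt] using this
  have hrt : Filter.Tendsto (fun z : ℂ => r (c / d * z)) (nhds 0) (nhds q) := by
    have := hrc.tendsto.comp ht
    rwa [hr0] at this
  have hpt : Filter.Tendsto p (nhds 0) (nhds q) := by
    have := hpc.tendsto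
    rwa [hp0] at this
  have hsum : ∀ᶠ z in nhds 0, p z + r (c / d * z) ≠ 0 := (hpt.add hrt).eventually_ne hqq
  have hone : ∀ᶠ z in nhds 0, 1 - c * z ≠ 0 := by
    refine ContinuousAt.eventually_ne (by fun_prop) ?_
    simp
  have hBne : ∀ᶠ z in nhds 0, (p z - q⁻¹) / (p z + q) ≠ 0 :=
    ((hpt.sub_const q⁻¹).div (hpt.add_const q) hqq).eventually_ne (div_ne_zero hqs hqq)
  have hev : ∀ᶠ z in nhds 0, P.eval z * c ^ m = Q.eval (c / d * z) * d ^ m := by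
    filter_upwards [hp, ht.eventually hr, hsum, hone, hBne] with z h1 h2 h3 h4 h5
    have h6 : d * (c / d * z) = c * z := by field_simp
    rw [h6] at h2
    have h7 : p z = r (c / d * z) := by
      -- Both squares solve the same linear equation; the sum of the two functions is near 2q ≠ 0,
      -- which excludes opposite signs.
      have h8 : (1 - c * z) * (p z + r (c / d * z)) * (p z - r (c / d * z)) = 0 := by
        linear_combination h1.1 - h2.1
      exact sub_eq_zero.1 ((mul_eq_zero.1 h8).resolve_left (mul_ne_zero h4 h3))
    rw [← h7] at h2
    have h9 := h1.2.trans h2.2.symm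
    have hs0 : ((sin (α / 2) : ℝ) : ℂ) ≠ 0 := by exact_mod_cast hs.ne'
    have h10 : ((q - q⁻¹) / (q + q)) ^ m / ((sin (α / 2) : ℝ) : ℂ) ^ (2 * m) ≠ 0 :=
      div_ne_zero (pow_ne_zero _ (div_ne_zero hqs hqq)) (pow_ne_zero _ hs0)
    have h11 := mul_right_cancel₀ h10 h9
    refine mul_right_cancel₀ (pow_ne_zero m h5) ?_
    linear_combination h11
  obtain ⟨a, ha⟩ : ∃ a : ℝ, Complex.exp ((a : ℂ) * Complex.I) = c / d :=
    ⟨Complex.arg (c / d), by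
      have := Complex.norm_mul_exp_arg_mul_I (c / d)
      rwa [hlam, Complex.ofReal_one, one_mul] at this⟩
  refine ⟨-a, ?_⟩
  have hexp : Complex.exp (-((-a : ℝ) : ℂ) * Complex.I) = c / d := by
    rw [Complex.ofReal_neg, neg_neg, ha]
  have hexp' : Complex.exp ((m : ℂ) * ((-a : ℝ) : ℂ) * Complex.I) = (d / c) ^ m := by
    rw [mul_assoc, Complex.exp_nat_mul, ← inv_div c d, ← ha, ← Complex.exp_neg,
      Complex.ofReal_neg, neg_mul]
  refine eq_of_infinite_eval_eq _ _ ((infinite_of_mem_nhds (0 : ℂ) hev).mono fun z hz => ?_)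
  have hz' : P.eval z * c ^ m = Q.eval (c / d * z) * d ^ m := hz
  rw [mem_ofPred_eq, rotatePolynomial, hexp, hexp', eval_C_mul, eval_comp, eval_C_mul, eval_X,
    div_pow]
  generalize Q.eval (c / d * z) = y at hz' ⊢
  field_simp
  linear_combination hz'

theorem theorem6 (m : ℕ) (hm : 1 ≤ m) (h : ℝ) (h_pos : 0 < h) (h_lt : h < 2) :
    delta m h = 4 * Real.arccos ((h / 2) ^ (1 / (m : ℝ))) ∧
    (∃! α : ℝ, α ∈ Set.Ioo 0 Real.pi ∧ h = 2 * Real.sin (α / 2) ^ m) ∧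
    ∀ α : ℝ, α ∈ Set.Ioo 0 Real.pi → h = 2 * Real.sin (α / 2) ^ m →
      ∀ P : Polynomial ℂ,
        IsExtremal m h P ↔ ∃ θ : ℝ, P = rotatePolynomial m θ (mrPolynomial m α) := by
  have hm0 : m ≠ 0 := Nat.one_le_iff_ne_zero.1 hm
  have hex := existsUnique_eq_two_mul_sin_pow hm0 h_pos h_lt
  refine ⟨?_, hex, ?_⟩
  · obtain ⟨α, ⟨hα, rfl⟩, -⟩ := hex
    rw [delta_eq hm0 hα, four_mul_arccos_eq hm0 hα]
  · rintro α hα rfl P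
    constructor
    · intro hP
      exact eq_rotatePolynomial_of_isExtremal hm0 hα hP
        ⟨mrPolynomial_mem_circlePolynomials m α, by
          rw [superlevelMeasure_mrPolynomial hm0 hα, delta_eq hm0 hα]⟩
    · rintro ⟨θ, rfl⟩
      exact isExtremal_rotatePolynomial hm0 hα θ
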